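/- **Notation.** Let $\mathcal X$ be a measurable space, $k\ge 1$, and $\mathcal H\subseteq[0,1]^{\mathcal X}$. For a list $\mu\in[0,1]^k$ and $y\in[0,1]$ put $\ell(\mu,y)=\min_{j\in[k]}|\mu_j-y|$; for a distribution $\mathcal D$ on $\mathcal X\times[0,1]$ and a $k$-list hypothesis $\mu:\mathcal X\to[0,1]^k$ put $\mathrm{err}_{\mathcal D}(\mu)=\mathbb E_{(x,y)\sim\mathcal D}\,\ell(\mu(x),y)$. A $k$-list learning algorithm is a map $\mathcal A$ from finite labelled samples $S$ to $k$-list hypotheses $\mathcal A(S)$. The distribution $\mathcal D$ is realizable by $\mathcal H$ if, for some $h^\star\in\mathcal H$ and some distribution $P$ on $\mathcal X$, it is the law of $(x,h^\star(x))$ with $x\sim P$. For $\gamma>0$, $\mathcal H$ $(\gamma,k)$-fat-shatters $(x_1,\dots,x_d)\in\mathcal X^d$ if there are $c_1,\dots,c_d\in[0,1]^k$ with $c_{i,j+1}\ge c_{i,j}+2\gamma$ for all $i$ and all $1\le j<k$, such that for every $b\in\{0,\dots,k\}^d$ there is $h_b\in\mathcal H$ such that for all $i$: $h_b(x_i)\le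 c_{i,1}-\gamma$ if $b_i=0$; $c_{i,b_i}+\gamma\le h_b(x_i)\le c_{i,b_i+1}-\gamma$ if $0<b_i<k$; $c_{i,k}+\gamma\le h_b(x_i)$ if $b_i=k$. The $(\gamma,k)$-fat-shattering dimension $\mathbb D^{\mathrm{fat}}_{\gamma,k}(\mathcal H)$ is the largest length of a $(\gamma,k)$-fat-shattered sequence ($\infty$ if there is no largest one). Measurability is understood as follows: only distributions $\mathcal D$ are considered for which, $P$ being the marginal on $\mathcal X$, the sets $\{x\in\mathcal X^m:\exists h\in\mathcal H\ \forall j\ a_j<h(x_j)<b_j\}$ are $P^m$-measurable for all $m$ and all real $a_j,b_j$ (automatic if $P$ is discrete, or if $\mathcal H$ consists of measurable functions and is separable for pointwise convergence). **Statement.** There are absolute constants $C>0$ and $p\in\mathbb N$ such that the following holds for all $\mathcal X$, all $\mathcal H\subseteq[0,1]^{\mathcal X}$, all $k\ge1$ and all $\gamma\in(0,1)$ with $d:=\mathbb D^{\mathrm{fat}}_{\gamma/2,k}(\mathcal H)<\infty$. There is a $k$-list learning algorithm $\mathcal A$ (depending on $\mathcal H,k,\gamma$ only) such that: 1. for every $n\ge1$,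 every $\delta\in(0,1)$ and every distribution $\mathcal D$ realizable by $\mathcal H$, with probability at least $1-\delta$ over $S\sim\mathcal D^n$, $$\mathrm{err}_{\mathcal D}(\mathcal A(S))\le C\,k\,\gamma+C\,\frac{k^8 d+\log(1/\delta)}{n}\,\log^p\!\Big(2+\frac{nk}{\gamma}\Big);$$ 2. if $\gamma=\varepsilon/(Ck)$ with $\varepsilon\in(0,1)$, then for every $\delta\in(0,1)$, every $$n\ge C\,\frac{k^8 d+\log(1/\delta)}{\varepsilon}\,\log^p\!\Big(2+\frac{k}{\varepsilon}+d+\log\frac1\delta\Big)$$ and every distribution $\mathcal D$ realizable by $\mathcal H$, with probability at least $1-\delta$ over $S\sim\mathcal D^n$, $\mathrm{err}_{\mathcal D}(\mathcal A(S))\le\varepsilon$. -/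

import Mathlib

open MeasureTheory

universe u

namespace ListRegression

/-- The loss of a `k`-list `μ` of labels in `[0,1]` on a target label `y`: the distance from `y`
to the closest entry of the list (for `1 ≤ k` the infimum is a minimum). -/
noncomputable def listLoss {k : ℕ} (μ : Fin k → unitInterval) (y : unitInterval) : ℝ :=
  ⨅ j : Fin k, |(μ j : ℝ) - (y : ℝ)|

/-- The expected loss of a `k`-list hypothesis with respect to a distribution `D`. -/
noncomputable def err {X : Type u} [MeasurableSpace X] {k : ℕ}
    (D : Measure (X × unitInterval)) (μ : X → Fin k → unitInterval) : ℝ :=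
  ∫ z, listLoss (μ z.1) z.2 ∂D

/-- The expected loss of `μ` is well defined and at most `r`. -/
def ErrLE {X : Type u} [MeasurableSpace X] {k : ℕ}
    (D : Measure (X × unitInterval)) (μ : X → Fin k → unitInterval) (r : ℝ) : Prop :=
  Integrable (fun z : X × unitInterval => listLoss (μ z.1) z.2) D ∧ err D μ ≤ r

/-- A `k`-list learning algorithm: it maps a labelled sample of any size to a `k`-list
hypothesis. -/
abbrev ListLearner (X : Type u) (k : ℕ) : Type u :=
  (n : ℕ) → (Fin n → X × unitInterval) → X → Fin k → unitInterval

/-- `H` `(γ,k)`-fat-shatters the sequence `x`. The anchors `c i 0, …, c i (k-1)` cut `[0,1]` into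
`k + 1` buckets numbered `0, …, k`; bucket `b` lies above anchor number `b - 1` (if `b ≠ 0`) and
below anchor number `b` (if `b ≠ k`), in both cases with margin `γ`. -/
def FatShatters {X : Type u} (H : Set (X → unitInterval)) (γ : ℝ) (k : ℕ) {d : ℕ}
    (x : Fin d → X) : Prop :=
  ∃ c : Fin d → Fin k → unitInterval,
    (∀ i : Fin d, ∀ j j' : Fin k, (j' : ℕ) = (j : ℕ) + 1 →
      (c i j : ℝ) + 2 * γ ≤ (c i j' : ℝ)) ∧
    ∀ b : Fin d → Fin (k + 1), ∃ h ∈ H, ∀ i : Fin d, ∀ j : Fin k,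
      ((b i : ℕ) = (j : ℕ) + 1 → (c i j : ℝ) + γ ≤ (h (x i) : ℝ)) ∧
      ((b i : ℕ) = (j : ℕ) → (h (x i) : ℝ) ≤ (c i j : ℝ) - γ)

/-- The `(γ,k)`-fat-shattering dimension: the size of the largest fat-shattered sequence,
`⊤` if there are arbitrarily long ones. -/
noncomputable def fatDim {X : Type u} (H : Set (X → unitInterval)) (γ : ℝ) (k : ℕ) : ℕ∞ :=
  ⨆ (d : ℕ) (_ : ∃ x : Fin d → X, FatShatters H γ k x), (d : ℕ∞)

/-- `D` is realizable by `H`: a draw from `D` is a draw `x` from some distribution `P` on the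
domain, labelled by `h x` for a fixed `h ∈ H`. -/
def Realizable {X : Type u} [MeasurableSpace X] (H : Set (X → unitInterval))
    (D : Measure (X × unitInterval)) : Prop :=
  ∃ h ∈ H, ∃ P : Measure X, IsProbabilityMeasure P ∧ AEMeasurable h P ∧
    D = P.map (fun x => (x, h x))

/-- The measurability condition on the class `H` with respect to the distribution `P` on the
domain: for each list of open intervals, the event that an i.i.d. sequence of points can be mapped
by some member of `H` into these intervals is measurable (up to null sets). It holds for all
classes if `P` is discrete, in particular on countable discrete domains, and for all `P` if `H`
consists of measurable functions and is separable for pointwise convergence. -/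
def MeasurableClass {X : Type u} [MeasurableSpace X] (H : Set (X → unitInterval))
    (P : Measure X) : Prop :=
  ∀ (m : ℕ) (a b : Fin m → ℝ),
    NullMeasurableSet
      {x : Fin m → X | ∃ h ∈ H, ∀ j, a j < (h (x j) : ℝ) ∧ (h (x j) : ℝ) < b j}
      (Measure.pi fun _ : Fin m => P)

/-- With probability at least `1 - δ` over an i.i.d. sample of size `n` from `D`, the output of
the learner `A` has error at most `r`; the failure event is measured by its outer measure. -/
def SucceedsWHP {X : Type u} [MeasurableSpace X] {k : ℕ} (A : ListLearner X k)
    (D : Measure (X × unitInterval)) (n : ℕ) (r δ : ℝ) : Prop :=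
  (Measure.pi fun _ : Fin n => D) {S | ¬ ErrLE D (A n S) r} ≤ ENNReal.ofReal δ

end ListRegression

namespace ListRegression

/-! ### Covering sets of naturals by short lists -/

/-! Rounding labels to a grid of width `γ` turns `H`, on any finite set of points, into a finite
class `V`. Its complexity is the number of patterns it shatters, a pattern being a set of pairs of a
coordinate and `k` anchors. A pattern shattered by `V` yields a sequence of the same length that `H`
fat-shatters at scale `γ / 2`, so it has at most `d` elements; hence the logarithm of the number of
patterns is about `d k log`.

The key point is a list version of the halving algorithm. Call a value at a coordinate heavy if
fixing it keeps more than the fraction `(k + 1) / (k + 2)` of the patterns. If `k + 1` heavy values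
were separated, many patterns would be shattered by all their fibers, and each of these could be
enlarged by the coordinate itself, giving more patterns than there are (`not_separated_heavy`). So
`k` entries cover all heavy values, and predicting them makes every mistake shrink the count by `(k
+ 1) / (k + 2)`: along any sequence there are at most `(k + 2) log (count)` mistakes
(`card_mistakes_le`).

Averaging this mistake bound over i.i.d. draws from a weight on the sample gives a weak predictor
built from `m` sample points (`exists_insertNth_weight_le`). Multiplicative weights produce `T` of
them such that each sample label is missed by fewer than `T / (k + 1)`, and by pigeonhole the labels
so rarely missed are again covered by `k` entries (`not_separated_popular`). The voted list
therefore has loss at most `5 * γ` on the whole sample, yet it is determined by `T * m` sample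
points and some indices.

This is a sample compression scheme. For a fixed description, the points outside the subsample are
fresh test points; a union bound over descriptions gives the error bound. The second claim inverts
this bound with `γ` proportional to `ε / k`. -/

/-- Some entry of the list `l` is at distance less than `r` from `y`. -/
def Covers {k : ℕ} (r : ℕ) (l : Fin k → ℕ) (y : ℕ) : Prop :=
  ∃ j, y < l j + r ∧ l j < y + r

/-- `y` is an increasing sequence with gaps at least `r`. -/
def Separated {k : ℕ} (r : ℕ) (y : Fin (k + 1) → ℕ) : Prop :=
  ∀ j : Fin k, y j.castSucc + r ≤ y j.succ

/-- Greedy choice: the minimum of `W` covers everything less than `r` above it, and the remaining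
elements contain no separated sequence one term shorter, since the minimum could be put in front of
it. -/
theorem exists_covers_of_not_separated {r : ℕ} (k : ℕ) (W : Set ℕ)
    (hW : ∀ y : Fin (k + 1) → ℕ, (∀ j, y j ∈ W) → ¬ Separated r y) :
    ∃ l : Fin k → ℕ, ∀ w ∈ W, Covers r l w := by
  classical
  induction k generalizing W with
  | zero =>
    refine ⟨Fin.elim0, fun w hw => ?_⟩
    exact absurd (fun j : Fin 0 => j.elim0) (hW (fun _ => w) fun _ => hw)
  | succ k ih =>
    rcases W.eq_empty_or_nonempty with rfl | hne
    · exact ⟨fun _ => 0, by simp⟩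
    · have hm : sInf W ∈ W := Nat.sInf_mem hne
      obtain ⟨l, hl⟩ := ih {w ∈ W | sInf W + r ≤ w} (by
        intro y hy hsep
        refine hW (Fin.cons (sInf W) y) (fun j => ?_) (fun j => ?_)
        · refine Fin.cases ?_ (fun i => ?_) j
          · simpa using hm
          · simpa using (hy i).1
        · refine Fin.cases ?_ (fun i => ?_) j
          · simpa using (hy 0).2
          · simpa [Fin.castSucc_succ] using hsep i)
      refine ⟨Fin.cons (sInf W) l, fun w hw => ?_⟩
      by_cases h : sInf W + r ≤ w
      · obtain ⟨j, hj⟩ := hl w ⟨hw, h⟩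
        exact ⟨j.succ, by simpa using hj⟩
      · refine ⟨0, ?_⟩
        have := Nat.sInf_le hw
        simp only [Fin.cons_zero]
        omega

open Classical in
/-- A list of length `k` that covers `W` up to distance `r`, if there is one. -/
noncomputable def coverList (r k : ℕ) (W : Set ℕ) : Fin k → ℕ :=
  if h : ∃ l : Fin k → ℕ, ∀ w ∈ W, Covers r l w then h.choose else 0

theorem covers_coverList {r : ℕ} {k : ℕ} {W : Set ℕ}
    (hW : ∀ y : Fin (k + 1) → ℕ, (∀ j, y j ∈ W) → ¬ Separated r y) {w : ℕ} (hw : w ∈ W) :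
    Covers r (coverList r k W) w := by
  have h := exists_covers_of_not_separated k W hW
  rw [coverList, dif_pos h]
  exact h.choose_spec w hw

/-! ### Shattered patterns of discrete classes -/

/-- A discrete version of fat-shattering: the pattern `c` is a set of pairs of a coordinate and a
list of anchors, and `V` realizes each assignment of buckets to the members of `c`. -/
def Shatters {N k g : ℕ} (V : Set (Fin N → Fin g)) (c : Finset (Fin N × (Fin k → Fin g))) : Prop :=
  ∀ b : Fin N × (Fin k → Fin g) → Fin (k + 1), ∃ f ∈ V, ∀ q ∈ c, ∀ j : Fin k,
    ((b q : ℕ) = (j : ℕ) + 1 → (q.2 j : ℕ) ≤ f q.1) ∧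
    ((b q : ℕ) = (j : ℕ) → (f q.1 : ℕ) + 3 ≤ q.2 j)

open Classical in
/-- The patterns shattered by `V`. -/
noncomputable def shat (k : ℕ) {N g : ℕ} (V : Set (Fin N → Fin g)) :
    Finset (Finset (Fin N × (Fin k → Fin g))) :=
  Finset.univ.filter (Shatters V)

section
variable {N k g : ℕ} {V V' : Set (Fin N → Fin g)}

@[simp] theorem mem_shat {c : Finset (Fin N × (Fin k → Fin g))} :
    c ∈ shat k V ↔ Shatters V c := by simp [shat]

theorem shat_mono (h : V ⊆ V') : shat k V ⊆ shat k V' := by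
  intro c hc
  rw [mem_shat] at *
  intro b
  obtain ⟨f, hf, hb⟩ := hc b
  exact ⟨f, h hf, hb⟩

theorem one_le_card_shat (h : V.Nonempty) : 1 ≤ (shat k V).card := by
  refine Finset.card_pos.2 ⟨∅, ?_⟩
  rw [mem_shat]
  intro b
  obtain ⟨f, hf⟩ := h
  exact ⟨f, hf, by simp⟩

/-- A class that is constant at a coordinate does not shatter patterns with this coordinate. -/
theorem Shatters.notMem_of_const (hk : 1 ≤ k) {t : Fin N} {y : Fin g}
    (hV : ∀ f ∈ V, f t = y) {c : Finset (Fin N × (Fin k → Fin g))} (hc : Shatters V c)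
    (a : Fin k → Fin g) : (t, a) ∉ c := by
  intro hta
  obtain ⟨f, hf, h0⟩ := hc (fun _ => 0)
  obtain ⟨f', hf', h1⟩ := hc (fun _ => ⟨1, by omega⟩)
  have h0 := (h0 _ hta ⟨0, hk⟩).2 (by simp)
  have h1 := (h1 _ hta ⟨0, hk⟩).1 (by simp)
  simp only [hV f hf, hV f' hf'] at h0 h1
  omega

/-- The members of `V` with value `y` at `t`. -/
def fiber (V : Set (Fin N → Fin g)) (t : Fin N) (y : Fin g) : Set (Fin N → Fin g) :=
  {f ∈ V | f t = y}

theorem fiber_subset (t : Fin N) (y : Fin g) : fiber V t y ⊆ V := fun _ h => h.1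

/-- With anchors `y 1, …, y k` at `t`, the fiber over `y j` realizes bucket `j`. So every pattern
shattered by all fibers stays shattered by `V` after adding `t`, while patterns shattered by a
single fiber never involve `t`. The two families are disjoint. -/
theorem card_shat_fiber_add_card_le (hk : 1 ≤ k) (t : Fin N) (y : Fin (k + 1) → Fin g)
    (hy : Separated 3 fun j => (y j : ℕ)) (I : Finset (Finset (Fin N × (Fin k → Fin g))))
    (hI : ∀ c ∈ I, ∀ j, Shatters (fiber V t (y j)) c) :
    (shat k (fiber V t (y 0))).card + I.card ≤ (shat k V).card := by
  classical
  set a : Fin k → Fin g := fun j => y j.succ with ha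
  have hconst : ∀ j, ∀ f ∈ fiber V t (y j), f t = y j := fun j f hf => hf.2
  have hinj : Set.InjOn (fun c : Finset (Fin N × (Fin k → Fin g)) => insert (t, a) c) I := by
    intro c hc c' hc' h
    have h1 := (hI c hc 0).notMem_of_const hk (hconst 0) a
    have h2 := (hI c' hc' 0).notMem_of_const hk (hconst 0) a
    have h3 := congrArg (fun s : Finset (Fin N × (Fin k → Fin g)) => s.erase (t, a)) h
    simpa [Finset.erase_insert h1, Finset.erase_insert h2] using h3
  rw [← Finset.card_image_of_injOn hinj, ← Finset.card_union_of_disjoint]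
  · refine Finset.card_le_card (Finset.union_subset (shat_mono (fiber_subset _ _)) ?_)
    intro c' hc'
    obtain ⟨c, hc, rfl⟩ := Finset.mem_image.1 hc'
    rw [mem_shat]
    intro b
    -- The bucket demanded at `t` selects the fiber from which `f` is taken.
    obtain ⟨f, hf, hb⟩ := hI c hc (b (t, a)) b
    refine ⟨f, hf.1, fun q hq j => ?_⟩
    rcases Finset.mem_insert.1 hq with rfl | hq
    · simp only [hf.2, ha]
      refine ⟨fun h => ?_, fun h => ?_⟩
      · have : b (t, a) = j.succ := Fin.ext (by simpa using h)
        rw [← ha, this]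
      · have : b (t, a) = j.castSucc := Fin.ext (by simpa using h)
        rw [← ha, this]
        exact hy j
    · exact hb q hq j
  · rw [Finset.disjoint_left]
    intro c hc hc'
    obtain ⟨c₀, _, rfl⟩ := Finset.mem_image.1 hc'
    exact (mem_shat.1 hc).notMem_of_const hk (hconst 0) a (Finset.mem_insert_self _ _)

/-- The values at `t` whose fiber shatters almost as many patterns as `V`. -/
def heavy (k : ℕ) (V : Set (Fin N → Fin g)) (t : Fin N) : Set ℕ :=
  {y | ∃ w : Fin g, (w : ℕ) = y ∧
    (k + 1) * (shat k V).card < (k + 2) * (shat k (fiber V t w)).card}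

/-- Each heavy fiber loses less than a fraction `1 / (k + 2)` of the patterns, so at least that
fraction is common to all `k + 1` fibers; together with the patterns of one heavy fiber this exceeds
the total. -/
theorem not_separated_heavy (hk : 1 ≤ k) (t : Fin N) (y : Fin (k + 1) → ℕ)
    (hy : ∀ j, y j ∈ heavy k V t) : ¬ Separated 3 y := by
  classical
  intro hsep
  choose w hw hlt using hy
  obtain rfl : (fun j => (w j : ℕ)) = y := funext hw
  set S := shat k V
  let B : Fin (k + 1) → Finset (Finset (Fin N × (Fin k → Fin g))) :=
    fun j => S \ shat k (fiber V t (w j))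
  let I := S \ Finset.univ.biUnion B
  have h1 := card_shat_fiber_add_card_le hk t w hsep I (by
    intro c hc j
    by_contra hcon
    simp only [I, B, Finset.mem_sdiff, Finset.mem_biUnion, Finset.mem_univ, true_and, not_exists,
      not_and, not_not] at hc
    exact hcon (mem_shat.1 (hc.2 j hc.1)))
  have hB : ∀ j, (k + 2) * (B j).card < S.card := by
    intro j
    have h := Finset.card_sdiff_add_card_eq_card
      (shat_mono (k := k) (fiber_subset (V := V) t (w j)))
    have := hlt j
    have h' : (B j).card + (shat k (fiber V t (w j))).card = S.card := h
    nlinarith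
  have hI : S.card ≤ I.card + ∑ j, (B j).card := by
    have h2 : S.card ≤ I.card + (Finset.univ.biUnion B).card := by
      have : S.card - (Finset.univ.biUnion B).card ≤ I.card := Finset.le_card_sdiff _ _
      omega
    exact h2.trans (Nat.add_le_add_left Finset.card_biUnion_le _)
  have hsum : (k + 2) * ∑ j, (B j).card ≤ (k + 1) * S.card := by
    rw [Finset.mul_sum]
    calc ∑ j, (k + 2) * (B j).card ≤ ∑ _j : Fin (k + 1), S.card :=
          Finset.sum_le_sum fun j _ => (hB j).le
      _ = (k + 1) * S.card := by simp
  have h0 := hlt 0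
  have h1' : (shat k (fiber V t (w 0))).card + I.card ≤ S.card := h1
  nlinarith

/-- The list of labels predicted at `t` by the class `V`. -/
noncomputable def predict (k : ℕ) (V : Set (Fin N → Fin g)) (t : Fin N) : Fin k → ℕ :=
  coverList 3 k (heavy k V t)

theorem card_shat_fiber_of_not_covers (hk : 1 ≤ k) {t : Fin N} {w : Fin g}
    (h : ¬ Covers 3 (predict k V t) w) :
    (k + 2) * (shat k (fiber V t w)).card ≤ (k + 1) * (shat k V).card := by
  by_contra hcon
  exact h (covers_coverList (not_separated_heavy hk t) ⟨w, rfl, not_le.1 hcon⟩)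

/-- The members of `V` that agree with `v` before `t`. -/
def agreeBefore (V : Set (Fin N → Fin g)) (v : Fin N → Fin g) (t : ℕ) : Set (Fin N → Fin g) :=
  {f ∈ V | ∀ i : Fin N, (i : ℕ) < t → f i = v i}

open Classical in
/-- The steps at which the prediction from the previous labels fails. -/
noncomputable def mistakes (k : ℕ) (V : Set (Fin N → Fin g)) (v : Fin N → Fin g) :
    Finset (Fin N) :=
  Finset.univ.filter fun t => ¬ Covers 3 (predict k (agreeBefore V v t) t) (v t)

/-- The pattern count of the version space is a potential: it never grows, each mistake multiplies
it by at most `(k + 1) / (k + 2)`, and it stays at least `1` because `v` survives. -/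
theorem pow_card_mistakes_le (hk : 1 ≤ k) {v : Fin N → Fin g} (hv : v ∈ V) :
    (k + 2) ^ (mistakes k V v).card ≤ (k + 1) ^ (mistakes k V v).card * (shat k V).card := by
  classical
  let q : ℕ → ℕ := fun t => ((mistakes k V v).filter fun i : Fin N => (i : ℕ) < t).card
  have key : ∀ t ≤ N, (k + 2) ^ q t * (shat k (agreeBefore V v t)).card ≤
      (k + 1) ^ q t * (shat k V).card := by
    intro t
    induction t with
    | zero =>
      intro _
      have h0 : q 0 = 0 := by simp [q]
      rw [h0]
      simpa using Finset.card_le_card (shat_mono (k := k) (fun f (hf : f ∈ agreeBefore V v 0) => hf.1))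
    | succ t ih =>
      intro ht
      have ih := ih (by omega)
      let t' : Fin N := ⟨t, ht⟩
      have hfib : agreeBefore V v (t + 1) = fiber (agreeBefore V v t) t' (v t') := by
        ext f
        simp only [agreeBefore, fiber, Set.mem_ofPred_eq]
        constructor
        · rintro ⟨h1, h2⟩
          exact ⟨⟨h1, fun i hi => h2 i (by omega)⟩, h2 t' (by simp [t'])⟩
        · rintro ⟨⟨h1, h2⟩, h3⟩
          refine ⟨h1, fun i hi => ?_⟩
          rcases Nat.lt_succ_iff_lt_or_eq.1 hi with h | h
          · exact h2 i h
          · obtain rfl : i = t' := Fin.ext h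
            exact h3
      by_cases hm : t' ∈ mistakes k V v
      · have hq : q (t + 1) = q t + 1 := by
          have : ((mistakes k V v).filter fun i : Fin N => (i : ℕ) < t + 1) =
              insert t' ((mistakes k V v).filter fun i : Fin N => (i : ℕ) < t) := by
            ext i
            simp only [Finset.mem_filter, Finset.mem_insert]
            constructor
            · rintro ⟨h1, h2⟩
              rcases Nat.lt_succ_iff_lt_or_eq.1 h2 with h | h
              · exact Or.inr ⟨h1, h⟩
              · exact Or.inl (Fin.ext h)
            · rintro (rfl | ⟨h1, h2⟩)
              · exact ⟨hm, by simp [t']⟩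
              · exact ⟨h1, by omega⟩
          simp only [q]
          rw [this, Finset.card_insert_of_notMem (by simp [t'])]
        have hshr := card_shat_fiber_of_not_covers (V := agreeBefore V v t) hk
          (t := t') (w := v t') (by simpa [mistakes] using hm)
        rw [hq, hfib, pow_succ, pow_succ]
        calc (k + 2) ^ q t * (k + 2) * (shat k (fiber (agreeBefore V v t) t' (v t'))).card
            = (k + 2) ^ q t * ((k + 2) * (shat k (fiber (agreeBefore V v t) t' (v t'))).card) := by
              ring
          _ ≤ (k + 2) ^ q t * ((k + 1) * (shat k (agreeBefore V v t)).card) := by gcongr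
          _ = (k + 1) * ((k + 2) ^ q t * (shat k (agreeBefore V v t)).card) := by ring
          _ ≤ (k + 1) * ((k + 1) ^ q t * (shat k V).card) := by gcongr
          _ = _ := by ring
      · have hq : q (t + 1) = q t := by
          simp only [q]
          congr 1
          ext i
          simp only [Finset.mem_filter]
          refine and_congr_right fun h1 => ⟨fun h2 => ?_, fun h2 => by omega⟩
          rcases Nat.lt_succ_iff_lt_or_eq.1 h2 with h | h
          · exact h
          · obtain rfl : i = t' := Fin.ext h
            exact absurd h1 hm
        rw [hq, hfib]
        exact (Nat.mul_le_mul_left _ (Finset.card_le_card (shat_mono (fiber_subset _ _)))).trans ih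
  have hq : q N = (mistakes k V v).card := by simp [q]
  have h := key N le_rfl
  rw [hq] at h
  have h1 : 1 ≤ (shat k (agreeBefore V v N)).card :=
    one_le_card_shat ⟨v, hv, fun _ _ => rfl⟩
  exact (Nat.le_mul_of_pos_right _ h1).trans h

theorem card_mistakes_le (hk : 1 ≤ k) {v : Fin N → Fin g} (hv : v ∈ V) :
    ((mistakes k V v).card : ℝ) ≤ (k + 2) * Real.log (shat k V).card := by
  have h := pow_card_mistakes_le hk hv
  set q := (mistakes k V v).card
  have hs : (0 : ℝ) < (shat k V).card := by
    exact_mod_cast one_le_card_shat (k := k) ⟨v, hv⟩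
  have h' : ((k : ℝ) + 2) ^ q ≤ (k + 1) ^ q * (shat k V).card := by exact_mod_cast h
  have h2 := Real.log_le_log (by positivity) h'
  rw [Real.log_mul (by positivity) (by positivity), Real.log_pow, Real.log_pow] at h2
  have h3 : 1 / ((k : ℝ) + 2) ≤ Real.log (k + 2) - Real.log (k + 1) := by
    rw [← Real.log_div (by positivity) (by positivity)]
    have := Real.one_sub_inv_le_log_of_pos (x := ((k : ℝ) + 2) / (k + 1)) (by positivity)
    refine le_trans (le_of_eq ?_) this
    field_simp
    ring
  have h4 : (q : ℝ) * (1 / ((k : ℝ) + 2)) ≤ Real.log (shat k V).card := by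
    have := mul_le_mul_of_nonneg_left h3 (Nat.cast_nonneg q : (0 : ℝ) ≤ q)
    nlinarith
  rw [mul_one_div, div_le_iff₀ (by positivity)] at h4
  linarith

/-- A set with at most `d` elements is the range of a sequence of length `d`, padded with `none`. -/
theorem card_finset_card_le {α : Type*} [Fintype α] (A : Finset (Finset α)) (d : ℕ)
    (h : ∀ c ∈ A, c.card ≤ d) : A.card ≤ (Fintype.card α + 1) ^ d := by
  classical
  let F : (Fin d → Option α) → Finset α := fun q => Finset.univ.filter fun a => ∃ i, q i = some a
  have hsub : A ⊆ Finset.univ.image F := by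
    intro c hc
    have hcd := h c hc
    refine Finset.mem_image.2 ⟨fun i => if hi : (i : ℕ) < c.card then
      some (c.equivFin.symm ⟨i, hi⟩ : c).1 else none, Finset.mem_univ _, ?_⟩
    ext a
    simp only [F, Finset.mem_filter, Finset.mem_univ, true_and]
    constructor
    · rintro ⟨i, hi⟩
      split_ifs at hi with h1
      rw [Option.some.injEq] at hi
      rw [← hi]
      exact Subtype.prop _
    · intro ha
      refine ⟨⟨c.equivFin ⟨a, ha⟩, lt_of_lt_of_le (Fin.is_lt _) hcd⟩, ?_⟩
      simp
  calc A.card ≤ (Finset.univ.image F).card := Finset.card_le_card hsub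
    _ ≤ (Finset.univ : Finset (Fin d → Option α)).card := Finset.card_image_le
    _ = _ := by simp

end
/-! ### Weak predictors from mistake bounds -/

/-- If along each sequence of `m + 1` elements of `ι` at most `M` steps are bad, then for each
weight on `ι` there are a step `t` and a choice `v` of the other elements such that the weight of
the elements that are bad at `t` is at most a fraction `M / (m + 1)` of the total weight. -/
theorem exists_insertNth_weight_le {ι : Type*} [Fintype ι] [Nonempty ι] {m : ℕ} {M : ℝ}
    (bad : (Fin (m + 1) → ι) → Fin (m + 1) → Prop) [∀ u t, Decidable (bad u t)]
    (hbad : ∀ u, ((Finset.univ.filter (bad u)).card : ℝ) ≤ M) (w : ι → ℝ) (hw : ∀ i, 0 < w i) :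
    ∃ (t : Fin (m + 1)) (v : Fin m → ι),
      (m + 1) * ∑ i, (if bad (t.insertNth (α := fun _ => ι) i v) t then w i else 0) ≤
        M * ∑ i, w i := by
  by_contra! hcon
  set W := ∑ i, w i
  -- Up to normalization, `u` is an i.i.d. sequence drawn from `w`. Separating the coordinate `t`
  -- from the others expresses the chance that step `t` is bad as an average over `v`; summed over
  -- `t`, it is an expected number of bad steps, which `M` bounds.
  have hfub : ∀ t : Fin (m + 1),
      ∑ u : Fin (m + 1) → ι, (∏ j, w (u j)) * (if bad u t then 1 else 0) =
      ∑ v : Fin m → ι, (∏ j, w (v j)) *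
        ∑ i, (if bad (t.insertNth (α := fun _ => ι) i v) t then w i else 0) := by
    intro t
    rw [← (Fin.insertNthEquiv (fun _ => ι) t).sum_comp, Fintype.sum_prod_type_right]
    refine Finset.sum_congr rfl fun v _ => ?_
    rw [Finset.mul_sum]
    refine Finset.sum_congr rfl fun i _ => ?_
    have he : Fin.insertNthEquiv (fun _ => ι) t (i, v) = t.insertNth (α := fun _ => ι) i v := rfl
    rw [he, Fin.prod_univ_succAbove _ t]
    simp only [Fin.insertNth_apply_same, Fin.insertNth_apply_succAbove]
    split_ifs <;> ring
  have hpow : ∀ r : ℕ, ∑ v : Fin r → ι, ∏ j, w (v j) = W ^ r := fun r => by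
    rw [Finset.sum_pow']
    simp
  have hlt : ∀ t : Fin (m + 1), M * W ^ (m + 1) <
      (m + 1) * ∑ u : Fin (m + 1) → ι, (∏ j, w (u j)) * (if bad u t then 1 else 0) := by
    intro t
    rw [hfub, pow_succ, ← hpow m, Finset.sum_mul, Finset.mul_sum, Finset.mul_sum]
    refine Finset.sum_lt_sum_of_nonempty Finset.univ_nonempty fun v _ => ?_
    have := mul_lt_mul_of_pos_left (hcon t v) (Finset.prod_pos fun j (_ : j ∈ Finset.univ) => hw (v j))
    linarith
  have hsum : ∑ _t : Fin (m + 1), M * W ^ (m + 1) <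
      ∑ t : Fin (m + 1), (m + 1) *
        ∑ u : Fin (m + 1) → ι, (∏ j, w (u j)) * (if bad u t then 1 else 0) :=
    Finset.sum_lt_sum_of_nonempty Finset.univ_nonempty fun t _ => hlt t
  rw [← Finset.mul_sum (a := ((m : ℝ) + 1)), Finset.sum_comm] at hsum
  have hle : ∑ u : Fin (m + 1) → ι, ∑ t, (∏ j, w (u j)) * (if bad u t then (1 : ℝ) else 0) ≤
      M * W ^ (m + 1) := by
    rw [← hpow, Finset.mul_sum]
    refine Finset.sum_le_sum fun u _ => ?_
    rw [← Finset.mul_sum, Finset.sum_boole, mul_comm]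
    exact mul_le_mul_of_nonneg_right (hbad u) (Finset.prod_nonneg fun j _ => (hw _).le)
  simp only [Finset.sum_const, Finset.card_univ, Fintype.card_fin, nsmul_eq_mul] at hsum
  push_cast at hsum
  have := mul_le_mul_of_nonneg_left hle (by positivity : (0 : ℝ) ≤ (m : ℝ) + 1)
  linarith

/-! ### Multiplicative weights -/

/-- Doubling the weight of every missed point at each round lets the total weight grow by a factor
at most `1 + ε`, since the next predictor is chosen for the current weights. -/
theorem exists_seq_pow_le_of_weak {ι Ω : Type*} [Fintype ι] (miss : Ω → ι → Prop)
    [∀ ω i, Decidable (miss ω i)] {ε : ℝ}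
    (weak : ∀ w : ι → ℝ, (∀ i, 0 < w i) →
      ∃ ω, ∑ i, (if miss ω i then w i else 0) ≤ ε * ∑ i, w i) (hε : 0 ≤ ε) (T : ℕ) :
    ∃ ω : Fin T → Ω, ∑ i, (2 : ℝ) ^ (∑ τ, if miss (ω τ) i then 1 else 0) ≤
      Fintype.card ι * (1 + ε) ^ T := by
  induction T with
  | zero => exact ⟨Fin.elim0, by simp⟩
  | succ T ih =>
    obtain ⟨ω, hω⟩ := ih
    set w : ι → ℝ := fun i => (2 : ℝ) ^ (∑ τ, if miss (ω τ) i then 1 else 0)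
    obtain ⟨ω₀, h₀⟩ := weak w (fun i => by positivity)
    refine ⟨Fin.cons ω₀ ω, ?_⟩
    have hstep : ∀ i, (2 : ℝ) ^ (∑ τ, if miss ((Fin.cons ω₀ ω : Fin (T + 1) → Ω) τ) i then 1 else 0)
        = w i + if miss ω₀ i then w i else 0 := by
      intro i
      rw [Fin.sum_univ_succ]
      simp only [Fin.cons_zero, Fin.cons_succ]
      split_ifs
      · rw [pow_add]
        simp only [w]
        ring
      · simp [w]
    rw [Finset.sum_congr rfl fun i _ => hstep i, Finset.sum_add_distrib]
    calc ∑ i, w i + ∑ i, (if miss ω₀ i then w i else 0) ≤ ∑ i, w i + ε * ∑ i, w i := by gcongr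
      _ = (∑ i, w i) * (1 + ε) := by ring
      _ ≤ (Fintype.card ι * (1 + ε) ^ T) * (1 + ε) := by gcongr
      _ = _ := by ring

/-- Boosting: a weak learner with error at most `1 / (4 (k + 1))` yields a sequence of hypotheses
such that each point is missed by a fraction less than `1 / (k + 1)` of them. -/
theorem exists_seq_miss_lt {ι Ω : Type*} [Fintype ι] (miss : Ω → ι → Prop)
    [∀ ω i, Decidable (miss ω i)] (k : ℕ)
    (weak : ∀ w : ι → ℝ, (∀ i, 0 < w i) →
      ∃ ω, ∑ i, (if miss ω i then w i else 0) ≤ 1 / (4 * ((k : ℝ) + 1)) * ∑ i, w i)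
    (T : ℕ) (hT0 : 0 < T) (hT : 4 * ((k : ℝ) + 1) * Real.log (Fintype.card ι) ≤ T) :
    ∃ ω : Fin T → Ω, ∀ i, (k + 1) * (∑ τ, if miss (ω τ) i then 1 else 0) < T := by
  obtain ⟨ω, hω⟩ := exists_seq_pow_le_of_weak miss weak (by positivity) T
  refine ⟨ω, fun i => ?_⟩
  set q := ∑ τ, if miss (ω τ) i then 1 else 0 with hq
  have hcard : (0 : ℝ) < Fintype.card ι := by
    have : Nonempty ι := ⟨i⟩
    exact_mod_cast Fintype.card_pos
  have h1 : (2 : ℝ) ^ q ≤ Fintype.card ι * (1 + 1 / (4 * ((k : ℝ) + 1))) ^ T :=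
    (Finset.single_le_sum (f := fun i => (2 : ℝ) ^ (∑ τ, if miss (ω τ) i then 1 else 0))
      (fun _ _ => by positivity) (Finset.mem_univ i)).trans hω
  have h2 := Real.log_le_log (by positivity) h1
  rw [Real.log_mul (by positivity) (by positivity), Real.log_pow, Real.log_pow] at h2
  have h3 : Real.log (1 + 1 / (4 * ((k : ℝ) + 1))) ≤ 1 / (4 * ((k : ℝ) + 1)) := by
    have := Real.log_le_sub_one_of_pos (x := 1 + 1 / (4 * ((k : ℝ) + 1))) (by positivity)
    linarith
  have hTR : (0 : ℝ) < T := by exact_mod_cast hT0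
  have h4 : (T : ℝ) * Real.log (1 + 1 / (4 * ((k : ℝ) + 1))) ≤ T * (1 / (4 * ((k : ℝ) + 1))) := by
    gcongr
  have h5 : ((k : ℝ) + 1) * (T * (1 / (4 * ((k : ℝ) + 1)))) = T / 4 := by
    field_simp
  -- The two error terms contribute `T / 4` each, and `log 2 > 1 / 2` makes the conclusion strict.
  have hl2 := Real.log_two_gt_d9
  have h6 : ((k : ℝ) + 1) * (q * Real.log 2) ≤ T / 2 := by
    have h7 : ((k : ℝ) + 1) * (q * Real.log 2) ≤ ((k : ℝ) + 1) *
        (Real.log (Fintype.card ι) + T * (1 / (4 * ((k : ℝ) + 1)))) := by gcongr; linarith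
    rw [mul_add, h5] at h7
    linarith
  have h8 : (0 : ℝ) ≤ ((k : ℝ) + 1) * q := by positivity
  have h9 : ((k : ℝ) + 1) * q < T := by nlinarith
  exact_mod_cast h9

/-! ### Voting -/

open Classical in
/-- The labels missed by a fraction less than `1 / (k + 1)` of the lists `l τ`. -/
def popular {T k : ℕ} (l : Fin T → Fin k → ℕ) : Set ℕ :=
  {y | (k + 1) * (∑ τ, if ¬ Covers 3 (l τ) y then 1 else 0) < T}

theorem Separated.le_of_lt {k r : ℕ} {y : Fin (k + 1) → ℕ} (hy : Separated r y)
    {i j : Fin (k + 1)} (hij : i < j) : y i + r ≤ y j := by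
  induction j using Fin.induction with
  | zero => exact absurd hij (by simp)
  | succ j ih =>
    have h := hy j
    rcases (Fin.le_castSucc_iff.2 hij).lt_or_eq with h' | rfl
    · have := ih h'
      omega
    · exact h

/-- Two labels within distance `2` of the same entry differ by at most `4`, so `k` entries cannot
serve `k + 1` labels with gaps at least `5`. -/
theorem exists_not_covers_of_separated {k : ℕ} (l : Fin k → ℕ) {y : Fin (k + 1) → ℕ}
    (hy : Separated 5 y) : ∃ i, ¬ Covers 3 l (y i) := by
  by_contra! hcon
  choose f hf using hcon
  obtain ⟨i, j, hij, hfij⟩ := Fintype.exists_ne_map_eq_of_card_lt f (by simp)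
  have hi := hf i
  have hj := hf j
  rw [hfij] at hi
  rcases lt_or_gt_of_ne hij with h | h
  · have := hy.le_of_lt h
    omega
  · have := hy.le_of_lt h
    omega

/-- Double counting: every list misses at least one of the `k + 1` separated labels, so the misses
number at least `T`, while popularity keeps them below `T`. -/
theorem not_separated_popular {T k : ℕ} (l : Fin T → Fin k → ℕ) (y : Fin (k + 1) → ℕ)
    (hy : ∀ j, y j ∈ popular l) : ¬ Separated 5 y := by
  classical
  intro hsep
  have h1 : ∑ j, (k + 1) * (∑ τ, if ¬ Covers 3 (l τ) (y j) then 1 else 0) <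
      ∑ _j : Fin (k + 1), T :=
    Finset.sum_lt_sum_of_nonempty Finset.univ_nonempty fun j _ => by
      have := hy j
      simp only [popular, Set.mem_ofPred_eq] at this
      convert this using 3
  rw [← Finset.mul_sum, Finset.sum_comm] at h1
  have h2 : T ≤ ∑ τ, ∑ j, if ¬ Covers 3 (l τ) (y j) then 1 else 0 := by
    calc T = ∑ _τ : Fin T, 1 := by simp
      _ ≤ _ := Finset.sum_le_sum fun τ _ => by
        obtain ⟨i, hi⟩ := exists_not_covers_of_separated (l τ) hsep
        refine le_trans ?_ (Finset.single_le_sum (fun _ _ => Nat.zero_le _) (Finset.mem_univ i))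
        simp [hi]
  simp only [Finset.sum_const, Finset.card_univ, Fintype.card_fin, smul_eq_mul] at h1
  have := Nat.mul_le_mul_left (k + 1) h2
  omega

/-- The list of labels on which most of the lists `l τ` agree. -/
noncomputable def vote {T k : ℕ} (l : Fin T → Fin k → ℕ) : Fin k → ℕ :=
  coverList 5 k (popular l)

theorem covers_vote {T k : ℕ} {l : Fin T → Fin k → ℕ} {y : ℕ} (hy : y ∈ popular l) :
    Covers 5 (vote l) y :=
  covers_coverList (not_separated_popular l) hy

/-! ### Generalization of compression schemes -/

/-- Restricting an i.i.d. sample to the range of an embedding and to its complement yields two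
independent i.i.d. samples. -/
theorem measurePreserving_split {Z : Type*} [MeasurableSpace Z] (D : Measure Z)
    [IsProbabilityMeasure D] {s n : ℕ} (e : Fin s ↪ Fin n) :
    MeasurePreserving (fun S : Fin n → Z =>
        (S ∘ e, fun i : {i : Fin n // i ∉ Set.range e} => S i))
      (Measure.pi fun _ => D) ((Measure.pi fun _ => D).prod (Measure.pi fun _ => D)) := by
  classical
  let σ : Fin s ⊕ {i : Fin n // i ∉ Set.range e} ≃ Fin n :=
    (Equiv.sumCongr (Equiv.ofInjective e e.injective) (Equiv.refl _)).trans
      (Equiv.sumCompl fun i => i ∈ Set.range e)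
  have h1 := (measurePreserving_piCongrLeft (fun _ : Fin n => D) σ).symm
  have h2 := measurePreserving_sumPiEquivProdPi
    (X := fun _ : Fin s ⊕ {i : Fin n // i ∉ Set.range e} => Z) (fun _ => D)
  exact h2.comp h1

theorem measurePreserving_fst_eval_snd {Y Z ι : Type*} [MeasurableSpace Y] [MeasurableSpace Z]
    [Fintype ι] (μ : Measure Y) [SFinite μ] (D : Measure Z) [IsProbabilityMeasure D] (i : ι) :
    MeasurePreserving (fun q : Y × (ι → Z) => (q.1, q.2 i))
      (μ.prod (Measure.pi fun _ => D)) (μ.prod D) :=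
  (MeasurePreserving.id μ).prod (measurePreserving_eval (fun _ : ι => D) i)

/-- Conditionally on the first component, a set of mass more than `r` is avoided by all the
independent test points with probability at most `(1 - r) ^ card ι`. -/
theorem measure_forall_le_and_lt_measure_le {Y Z ι : Type*} [MeasurableSpace Y] [MeasurableSpace Z]
    [Fintype ι] (μ : Measure Y) [IsProbabilityMeasure μ] (D : Measure Z) [IsProbabilityMeasure D]
    {L : Y × Z → ℝ} (hL : Measurable L) (τ : ℝ) {r : ℝ} (hr : 0 ≤ r) :
    (μ.prod (Measure.pi fun _ : ι => D))
      {q | (∀ i, L (q.1, q.2 i) ≤ τ) ∧ ENNReal.ofReal r < D {z | τ < L (q.1, z)}} ≤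
      ENNReal.ofReal (Real.exp (-(r * Fintype.card ι))) := by
  have hmeas : Measurable fun y => D {z | τ < L (y, z)} :=
    measurable_measure_prodMk_left (s := {q | τ < L q}) (measurableSet_lt measurable_const hL)
  have hset : MeasurableSet {q : Y × (ι → Z) |
      (∀ i, L (q.1, q.2 i) ≤ τ) ∧ ENNReal.ofReal r < D {z | τ < L (q.1, z)}} := by
    have h1 : MeasurableSet {q : Y × (ι → Z) | ∀ i, L (q.1, q.2 i) ≤ τ} := by
      rw [Set.ofPred_forall]
      exact MeasurableSet.iInter fun i =>
        measurableSet_le (hL.comp (by fun_prop)) measurable_const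
    exact h1.inter (measurableSet_lt measurable_const (hmeas.comp measurable_fst))
  rw [Measure.prod_apply hset]
  refine (lintegral_mono (g := fun _ => ENNReal.ofReal (Real.exp (-(r * Fintype.card ι))))
    fun y => ?_).trans (by simp)
  by_cases hy : ENNReal.ofReal r < D {z | τ < L (y, z)}
  · have hpre : (Prod.mk y ⁻¹' {q : Y × (ι → Z) | (∀ i, L (q.1, q.2 i) ≤ τ) ∧
        ENNReal.ofReal r < D {z | τ < L (q.1, z)}}) = Set.univ.pi fun _ => {z | τ < L (y, z)}ᶜ := by
      ext v
      simp [hy]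
    rw [hpre, Measure.pi_pi]
    have hm : MeasurableSet {z | τ < L (y, z)} :=
      measurableSet_lt measurable_const (hL.comp measurable_prodMk_left)
    have h1 : D {z | τ < L (y, z)}ᶜ ≤ ENNReal.ofReal (Real.exp (-r)) := by
      rw [prob_compl_eq_one_sub hm]
      calc 1 - D {z | τ < L (y, z)} ≤ 1 - ENNReal.ofReal r := tsub_le_tsub_left hy.le _
        _ = ENNReal.ofReal (1 - r) := by
          rw [ENNReal.ofReal_sub _ hr, ENNReal.ofReal_one]
        _ ≤ _ := ENNReal.ofReal_le_ofReal (by have := Real.add_one_le_exp (-r); linarith)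
    calc ∏ _i : ι, D {z | τ < L (y, z)}ᶜ ≤ ∏ _i : ι, ENNReal.ofReal (Real.exp (-r)) :=
          Finset.prod_le_prod' fun _ _ => h1
      _ = ENNReal.ofReal (Real.exp (-(r * Fintype.card ι))) := by
        rw [Finset.prod_const, ← ENNReal.ofReal_pow (Real.exp_pos _).le, ← Real.exp_nat_mul,
          Finset.card_univ]
        congr 2
        ring
  · have hpre : (Prod.mk y ⁻¹' {q : Y × (ι → Z) | (∀ i, L (q.1, q.2 i) ≤ τ) ∧
        ENNReal.ofReal r < D {z | τ < L (q.1, z)}}) = ∅ := by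
      ext v
      simp only [Set.mem_preimage, Set.mem_ofPred_eq, hy, and_false, Set.mem_empty_iff_false]
    rw [hpre]
    simp

/-- A hypothesis that is determined by the subsample `S ∘ e` and has loss at most `τ` on the whole
sample has a small probability of loss larger than `τ`. -/
theorem measure_consistent_and_not_le {Z : Type*} [MeasurableSpace Z] (D : Measure Z)
    [IsProbabilityMeasure D] {s n : ℕ} (e : Fin s ↪ Fin n) (L : (Fin s → Z) × Z → ℝ)
    (hL : AEMeasurable L ((Measure.pi fun _ => D).prod D)) (τ : ℝ) {r : ℝ} (hr : 0 ≤ r) :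
    (Measure.pi fun _ : Fin n => D)
      {S | (∀ i, L (S ∘ e, S i) ≤ τ) ∧
        ¬ (AEMeasurable (fun z => L (S ∘ e, z)) D ∧
          D {z | τ < L (S ∘ e, z)} ≤ ENNReal.ofReal r)} ≤
      ENNReal.ofReal (Real.exp (-(r * ((n : ℝ) - s)))) := by
  classical
  let ι := {i : Fin n // i ∉ Set.range e}
  set μ : Measure (Fin s → Z) := Measure.pi fun _ => D
  -- The loss is only almost everywhere measurable; the estimate is made for a measurable version
  -- and transferred back through almost every section and every test point.
  obtain ⟨L', hL', hLL'⟩ := hL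
  have hsec : ∀ᵐ u ∂μ, ∀ᵐ z ∂D, L (u, z) = L' (u, z) := Measure.ae_ae_of_ae_prod hLL'
  have hsplit := measurePreserving_split D e
  have hcard : (Fintype.card ι : ℝ) = (n : ℝ) - s := by
    have h1 : Fintype.card ι = Fintype.card (Fin n) - Fintype.card (Set.range e) :=
      Fintype.card_subtype_compl fun i => i ∈ Set.range e
    rw [Set.card_range_of_injective e.injective, Fintype.card_fin, Fintype.card_fin] at h1
    have h2 : s ≤ n := by simpa using Fintype.card_le_of_embedding e
    rw [h1, Nat.cast_sub h2]
  have hae1 : ∀ᵐ S ∂(Measure.pi fun _ : Fin n => D), ∀ᵐ z ∂D, L (S ∘ e, z) = L' (S ∘ e, z) :=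
    (hsplit.quasiMeasurePreserving.ae
      (Measure.quasiMeasurePreserving_fst.ae hsec))
  have hae2 : ∀ᵐ S ∂(Measure.pi fun _ : Fin n => D), ∀ i : ι,
      L (S ∘ e, S i) = L' (S ∘ e, S i) := by
    rw [ae_all_iff]
    intro i
    exact hsplit.quasiMeasurePreserving.ae
      ((measurePreserving_fst_eval_snd μ D i).quasiMeasurePreserving.ae hLL')
  set E : Set ((Fin s → Z) × (ι → Z)) :=
    {q | (∀ i, L' (q.1, q.2 i) ≤ τ) ∧ ENNReal.ofReal r < D {z | τ < L' (q.1, z)}}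
  have hE := measure_forall_le_and_lt_measure_le (ι := ι) μ D hL' τ hr
  rw [hcard] at hE
  refine le_trans ?_ (((hsplit.measure_preimage_le E)).trans hE)
  refine measure_mono_ae ?_
  filter_upwards [hae1, hae2] with S h1 h2 hS
  obtain ⟨hS1, hS2⟩ := hS
  refine ⟨fun i => ?_, ?_⟩
  · exact (h2 i) ▸ hS1 i
  · by_contra hcon
    refine hS2 ⟨⟨fun z => L' (S ∘ e, z), hL'.comp measurable_prodMk_left, h1⟩, ?_⟩
    refine le_trans (le_of_eq (measure_congr ?_)) (not_lt.1 hcon)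
    filter_upwards [h1] with z hz
    show (τ < L (S ∘ e, z)) = (τ < L' (S ∘ e, z))
    rw [hz]

/-! ### Discretization of a class of functions -/

/-- The number of buckets of width `γ`. -/
noncomputable abbrev gridSize (γ : ℝ) : ℕ := ⌊1 / γ⌋₊ + 1

/-- The bucket of a label. -/
noncomputable def disc (γ : ℝ) (y : unitInterval) : Fin (gridSize γ) :=
  Fin.ofNat _ ⌊(y : ℝ) / γ⌋₊

theorem disc_val {γ : ℝ} (hγ : 0 < γ) (y : unitInterval) : (disc γ y : ℕ) = ⌊(y : ℝ) / γ⌋₊ := by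
  refine Nat.mod_eq_of_lt (Nat.lt_succ_of_le (Nat.floor_mono ?_))
  gcongr
  exact y.2.2

theorem disc_mul_le {γ : ℝ} (hγ : 0 < γ) (y : unitInterval) : (disc γ y : ℕ) * γ ≤ y := by
  rw [disc_val hγ, ← le_div_iff₀ hγ]
  exact Nat.floor_le (div_nonneg y.2.1 hγ.le)

theorem lt_disc_add_one_mul {γ : ℝ} (hγ : 0 < γ) (y : unitInterval) :
    (y : ℝ) < ((disc γ y : ℕ) + 1) * γ := by
  rw [disc_val hγ, ← div_lt_iff₀ hγ]
  exact Nat.lt_floor_add_one _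

theorem measurable_disc (γ : ℝ) : Measurable (disc γ) := by
  have h : Measurable fun y : unitInterval => ⌊(y : ℝ) / γ⌋₊ :=
    Nat.measurable_floor.comp (measurable_subtype_coe.div_const γ)
  exact (measurable_of_countable (Fin.ofNat (gridSize γ))).comp h

section
variable {X : Type u} {H : Set (X → unitInterval)} {γ : ℝ}

/-- The discretized restrictions of `H` to the points `x`; the bucket `a` is fuzzy, with the open
interval from `(a - 1) γ` to `(a + 1) γ` as its range. -/
def traces (H : Set (X → unitInterval)) (γ : ℝ) {N : ℕ} (x : Fin N → X) :
    Set (Fin N → Fin (gridSize γ)) :=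
  {f | ∃ h ∈ H, ∀ i, (((f i : ℕ) : ℝ) - 1) * γ < h (x i) ∧ (h (x i) : ℝ) < (((f i : ℕ) : ℝ) + 1) * γ}

theorem disc_mem_traces (hγ : 0 < γ) {N : ℕ} (x : Fin N → X) {h : X → unitInterval} (hh : h ∈ H) :
    (fun i => disc γ (h (x i))) ∈ traces H γ x := by
  refine ⟨h, hh, fun i => ⟨?_, lt_disc_add_one_mul hγ _⟩⟩
  have := disc_mul_le hγ (h (x i))
  nlinarith

/-- The gap `3` in `Shatters` pays for the fuzziness of both buckets, one `γ` on each side, and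
leaves room `γ` for the two margins `γ / 2`. -/
theorem Shatters.fatShatters (hγ : 0 < γ) {N k : ℕ} {x : Fin N → X}
    {c : Finset (Fin N × (Fin k → Fin (gridSize γ)))} (hc : Shatters (traces H γ x) c) :
    FatShatters H (γ / 2) k fun i : Fin c.card => x (c.equivFin.symm i).1.1 := by
  classical
  have hlow : ∀ q ∈ c, ∀ j, 3 ≤ (q.2 j : ℕ) := by
    intro q hq j
    obtain ⟨f, -, hf⟩ := hc fun _ => j.castSucc
    have := (hf q hq j).2 (by simp)
    omega
  have hhigh : ∀ q ∈ c, ∀ j, (((q.2 j : ℕ) : ℝ) - 1) * γ ≤ 1 := by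
    intro q hq j
    obtain ⟨f, ⟨h, -, hh⟩, hf⟩ := hc fun _ => j.succ
    have h1 : ((q.2 j : ℕ) : ℝ) ≤ (f q.1 : ℕ) := by exact_mod_cast (hf q hq j).1 (by simp)
    have h2 := (hh q.1).1
    have h3 := (h (x q.1)).2.2
    nlinarith
  have hgap : ∀ q ∈ c, ∀ j j' : Fin k, (j' : ℕ) = (j : ℕ) + 1 →
      (q.2 j : ℕ) + 1 ≤ (q.2 j' : ℕ) := by
    intro q hq j j' hj
    obtain ⟨f, -, hf⟩ := hc fun _ => j.succ
    have h1 := (hf q hq j).1 (by simp)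
    have h2 := (hf q hq j').2 (by simp [hj])
    omega
  -- For a discrete anchor `a`, values above exceed `(a - 1) * γ` and values below are less than `(a
  -- - 2) * γ`; the real anchor is the midpoint.
  refine ⟨fun i j => ⟨(((c.equivFin.symm i).1.2 j : ℕ) - 3 / 2) * γ, ?_, ?_⟩, ?_, ?_⟩
  · have h : (3 : ℝ) ≤ ((c.equivFin.symm i).1.2 j : ℕ) := by
      exact_mod_cast hlow _ (c.equivFin.symm i).2 j
    exact mul_nonneg (by linarith) hγ.le
  · have := hhigh _ (c.equivFin.symm i).2 j
    nlinarith
  · intro i j j' hj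
    have h : (((c.equivFin.symm i).1.2 j : ℕ) : ℝ) + 1 ≤ ((c.equivFin.symm i).1.2 j' : ℕ) := by
      exact_mod_cast hgap _ (c.equivFin.symm i).2 j j' hj
    simp only
    nlinarith
  · intro b
    obtain ⟨f, ⟨h, hH, hh⟩, hf⟩ := hc fun q => if hq : q ∈ c then b (c.equivFin ⟨q, hq⟩) else 0
    refine ⟨h, hH, fun i j => ?_⟩
    have hq := (c.equivFin.symm i).2
    have hfi := hf _ hq j
    rw [dif_pos hq] at hfi
    simp only [Subtype.coe_eta, Equiv.apply_symm_apply] at hfi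
    obtain ⟨h1, h2⟩ := hh (c.equivFin.symm i).1.1
    refine ⟨fun hb => ?_, fun hb => ?_⟩
    · have h3 : (((c.equivFin.symm i).1.2 j : ℕ) : ℝ) ≤ (f (c.equivFin.symm i).1.1 : ℕ) := by
        exact_mod_cast hfi.1 hb
      simp only
      nlinarith
    · have h3 : ((f (c.equivFin.symm i).1.1 : ℕ) : ℝ) + 3 ≤ ((c.equivFin.symm i).1.2 j : ℕ) := by
        exact_mod_cast hfi.2 hb
      simp only
      nlinarith

theorem card_shat_traces_le (hγ : 0 < γ) {k d N : ℕ} (hd : fatDim H (γ / 2) k = (d : ℕ∞))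
    (x : Fin N → X) : (shat k (traces H γ x)).card ≤ (N * gridSize γ ^ k + 1) ^ d := by
  have h := card_finset_card_le (shat k (traces H γ x)) d (by
    intro c hc
    have h1 := (mem_shat.1 hc).fatShatters hγ
    have h2 : (c.card : ℕ∞) ≤ fatDim H (γ / 2) k :=
      le_iSup₂_of_le (f := fun (d : ℕ) (_ : ∃ x : Fin d → X, FatShatters H (γ / 2) k x) => (d : ℕ∞))
        c.card ⟨_, h1⟩ le_rfl
    rw [hd] at h2
    exact_mod_cast h2)
  simpa using h

theorem card_mistakes_traces_le (hγ : 0 < γ) {k d N : ℕ} (hk : 1 ≤ k)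
    (hd : fatDim H (γ / 2) k = (d : ℕ∞)) (x : Fin N → X) {h : X → unitInterval} (hh : h ∈ H) :
    ((mistakes k (traces H γ x) fun i => disc γ (h (x i))).card : ℝ) ≤
      (k + 2) * (d * Real.log (N * (gridSize γ : ℝ) ^ k + 1)) := by
  refine (card_mistakes_le hk (disc_mem_traces hγ x hh)).trans ?_
  have h1 := card_shat_traces_le hγ hd x
  have h2 : (1 : ℝ) ≤ (shat k (traces H γ x)).card := by
    exact_mod_cast one_le_card_shat ⟨_, disc_mem_traces hγ x hh⟩
  rw [← Real.log_pow]
  gcongr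
  exact_mod_cast h1

/-! ### The hypotheses of the learner -/

/-- The prediction at `x` from the labelled points `p i` with `i < t` and the unlabelled others. -/
noncomputable def weakList (H : Set (X → unitInterval)) (γ : ℝ) (k : ℕ) {m : ℕ}
    (p : Fin m → X × unitInterval) (t : Fin (m + 1)) (x : X) : Fin k → ℕ :=
  predict k (agreeBefore (traces H γ (t.insertNth (α := fun _ => X) x fun i => (p i).1))
    (t.insertNth (α := fun _ => Fin (gridSize γ)) 0 fun i => disc γ (p i).2) t) t

/-- The vote of the predictions from the subsamples `p ∘ I τ`. -/
noncomputable def boostList (H : Set (X → unitInterval)) (γ : ℝ) (k : ℕ) {T m s : ℕ}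
    (I : Fin T → Fin m → Fin s) (t : Fin T → Fin (m + 1)) (p : Fin s → X × unitInterval) (x : X) :
    Fin k → ℕ :=
  vote fun τ => weakList H γ k (p ∘ I τ) (t τ) x

/-- The list of labels given by a list of buckets. -/
noncomputable def toLabels (γ : ℝ) {k : ℕ} (l : Fin k → ℕ) : Fin k → unitInterval :=
  fun j => Set.projIcc 0 1 zero_le_one (l j * γ)

theorem listLoss_le {k : ℕ} (l : Fin k → unitInterval) (y : unitInterval) (j : Fin k) :
    listLoss l y ≤ |(l j : ℝ) - y| :=
  ciInf_le ⟨0, by rintro _ ⟨i, rfl⟩; positivity⟩ j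

theorem listLoss_nonneg {k : ℕ} (l : Fin k → unitInterval) (y : unitInterval) :
    0 ≤ listLoss l y :=
  Real.iInf_nonneg fun _ => abs_nonneg _

theorem listLoss_le_one {k : ℕ} (hk : 1 ≤ k) (l : Fin k → unitInterval) (y : unitInterval) :
    listLoss l y ≤ 1 := by
  refine (listLoss_le l y ⟨0, hk⟩).trans (abs_le.2 ⟨?_, ?_⟩)
  · have := (l ⟨0, hk⟩).2.1
    have := y.2.2
    linarith
  · have := (l ⟨0, hk⟩).2.2
    have := y.2.1
    linarith

theorem measurable_listLoss {k : ℕ} (l : Fin k → unitInterval) : Measurable (listLoss l) :=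
  Measurable.iInf fun j => by fun_prop

/-- The buckets differ by at most `4`, and rounding the label costs one more `γ`; projecting to
`[0,1]` does not increase the distance. -/
theorem listLoss_toLabels_le (hγ : 0 < γ) {k : ℕ} {l : Fin k → ℕ} {y : unitInterval}
    (h : Covers 5 l (disc γ y)) : listLoss (toLabels γ l) y ≤ 5 * γ := by
  obtain ⟨j, h1, h2⟩ := h
  refine (listLoss_le _ y j).trans ?_
  have hproj : |((toLabels γ l j : unitInterval) : ℝ) - y| ≤ |(l j : ℝ) * γ - y| := by
    have h := Set.abs_projIcc_sub_projIcc (a := (0 : ℝ)) (b := 1) zero_le_one (c := l j * γ) (d := y)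
    rwa [Set.projIcc_of_mem zero_le_one y.2] at h
  refine hproj.trans (abs_le.2 ?_)
  have h3 := disc_mul_le hγ y
  have h4 := lt_disc_add_one_mul hγ y
  have h5 : (((disc γ y : ℕ) : ℝ)) + 1 ≤ l j + 5 := by exact_mod_cast h1
  have h6 : (l j : ℝ) + 1 ≤ (disc γ y : ℕ) + 5 := by exact_mod_cast h2
  constructor <;> nlinarith

/-- The label at `t` is never read, so the placeholder `0` inserted there by `weakList` is harmless.
-/
theorem agreeBefore_congr {N g : ℕ} (V : Set (Fin N → Fin g)) {v v' : Fin N → Fin g} {t : Fin N}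
    (h : ∀ i, i ≠ t → v i = v' i) : agreeBefore V v t = agreeBefore V v' t := by
  ext f
  simp only [agreeBefore, Set.mem_ofPred_eq]
  refine and_congr_right fun _ => forall_congr' fun i => imp_congr_right fun hi => ?_
  rw [h i (by rintro rfl; exact lt_irrefl _ hi)]

/-- The points used by all rounds, padded to exactly `T * m` of them, form one subsample, so that
all codes have the same shape. -/
theorem exists_embedding_factor {T m n : ℕ} (v : Fin T → Fin m → Fin n) (h : T * m ≤ n) :
    ∃ (e : Fin (T * m) ↪ Fin n) (I : Fin T → Fin m → Fin (T * m)),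
      ∀ τ i, e (I τ i) = v τ i := by
  classical
  let A : Finset (Fin n) := Finset.univ.image fun q : Fin T × Fin m => v q.1 q.2
  have hA : A.card ≤ T * m := by
    refine Finset.card_image_le.trans ?_
    simp
  obtain ⟨B, hAB, hB⟩ := Finset.exists_superset_card_eq hA (by simpa using h)
  have hmem : ∀ τ i, ∃ a, B.orderEmbOfFin hB a = v τ i := by
    intro τ i
    have : v τ i ∈ Set.range (B.orderEmbOfFin hB) := by
      rw [Finset.range_orderEmbOfFin]
      exact hAB (Finset.mem_image.2 ⟨(τ, i), Finset.mem_univ _, rfl⟩)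
    exact this
  choose I hI using hmem
  exact ⟨(B.orderEmbOfFin hB).toEmbedding, I, hI⟩

/-- Each realizable sample is fitted by the hypothesis determined by a short subsample. -/
theorem exists_boostList_consistent (hγ : 0 < γ) {k d m n T : ℕ} (hk : 1 ≤ k)
    (hd : fatDim H (γ / 2) k = (d : ℕ∞)) (hn : 1 ≤ n) (hT0 : 0 < T)
    (hT : 4 * ((k : ℝ) + 1) * Real.log n ≤ T) (hTm : T * m ≤ n)
    (hm : 4 * ((k : ℝ) + 1) * ((k + 2) *
      (d * Real.log (((m + 1 : ℕ) : ℝ) * (gridSize γ : ℝ) ^ k + 1))) ≤ m + 1)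
    {h : X → unitInterval} (hh : h ∈ H) (S : Fin n → X × unitInterval)
    (hS : ∀ i, (S i).2 = h (S i).1) :
    ∃ (e : Fin (T * m) ↪ Fin n) (I : Fin T → Fin m → Fin (T * m)) (t : Fin T → Fin (m + 1)),
      ∀ i, listLoss (toLabels γ (boostList H γ k I t (S ∘ e) (S i).1)) (S i).2 ≤ 5 * γ := by
  classical
  have : Nonempty (Fin n) := ⟨⟨0, hn⟩⟩
  let miss : Fin (m + 1) × (Fin m → Fin n) → Fin n → Prop := fun ω i =>
    ¬ Covers 3 (weakList H γ k (S ∘ ω.2) ω.1 (S i).1) (disc γ (S i).2)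
  let bad : (Fin (m + 1) → Fin n) → Fin (m + 1) → Prop := fun u t =>
    t ∈ mistakes k (traces H γ fun j => (S (u j)).1) fun j => disc γ (h (S (u j)).1)
  -- A mistake of the sequential predictor at step `t` is a miss of the weak predictor at the test
  -- point inserted at `t`: the points of the sequence are all visible, the labels used are those
  -- before `t`.
  have hbm : ∀ (t : Fin (m + 1)) (v : Fin m → Fin n) (i : Fin n),
      bad (t.insertNth (α := fun _ => Fin n) i v) t ↔ miss (t, v) i := by
    intro t v i
    simp only [bad, miss, mistakes, weakList, Finset.mem_filter, Finset.mem_univ, true_and,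
      Fin.insertNth_apply_same, hS i]
    have hx : (fun j => (S (t.insertNth (α := fun _ => Fin n) i v j)).1) =
        t.insertNth (α := fun _ => X) (S i).1 fun j => (S (v j)).1 := by
      ext j
      refine Fin.succAboveCases t ?_ (fun l => ?_) j <;> simp
    have hl : ∀ V : Set (Fin (m + 1) → Fin (gridSize γ)), agreeBefore V (fun j =>
        disc γ (h (S (t.insertNth (α := fun _ => Fin n) i v j)).1)) t = agreeBefore V
        (t.insertNth (α := fun _ => Fin (gridSize γ)) 0 fun j => disc γ (S (v j)).2) t := by
      intro V
      refine agreeBefore_congr V fun j hj => ?_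
      obtain ⟨l, rfl⟩ := Fin.exists_succAbove_eq hj
      simp [hS]
    rw [hx, hl]
    rfl
  have hweak : ∀ w : Fin n → ℝ, (∀ i, 0 < w i) →
      ∃ ω, ∑ i, (if miss ω i then w i else 0) ≤ 1 / (4 * ((k : ℝ) + 1)) * ∑ i, w i := by
    intro w hw
    obtain ⟨t, v, htv⟩ := exists_insertNth_weight_le bad (M := (k + 2) *
      (d * Real.log (((m + 1 : ℕ) : ℝ) * (gridSize γ : ℝ) ^ k + 1))) (fun u => by
        refine le_trans (le_of_eq ?_)
          (card_mistakes_traces_le hγ hk hd (fun j => (S (u j)).1) hh)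
        congr 2
        ext t
        simp [bad]) w hw
    refine ⟨(t, v), ?_⟩
    simp only [hbm] at htv
    have hW : 0 < ∑ i, w i := Finset.sum_pos (fun i _ => hw i) Finset.univ_nonempty
    rw [div_mul_eq_mul_div, one_mul, le_div_iff₀ (by positivity)]
    refine le_of_mul_le_mul_left ?_ (by positivity : (0 : ℝ) < (m : ℝ) + 1)
    have h1 := mul_le_mul_of_nonneg_right hm hW.le
    have h2 := mul_le_mul_of_nonneg_left htv (by positivity : (0 : ℝ) ≤ 4 * ((k : ℝ) + 1))
    linarith
  obtain ⟨ω, hω⟩ := exists_seq_miss_lt miss k hweak T hT0 (by simpa using hT)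
  obtain ⟨e, I, heI⟩ := exists_embedding_factor (fun τ => (ω τ).2) hTm
  refine ⟨e, I, fun τ => (ω τ).1, fun i => listLoss_toLabels_le hγ (covers_vote ?_)⟩
  have hcomp : ∀ τ, (S ∘ e) ∘ I τ = S ∘ (ω τ).2 := fun τ => by
    ext1 j
    simp [heI]
  simp only [popular, Set.mem_ofPred_eq, hcomp]
  convert hω i using 3

/-! ### Measurability of the hypotheses -/

variable [MeasurableSpace X]

theorem MeasurableClass.reindex {P : Measure X} (hP : MeasurableClass H P) {N m : ℕ}
    (π : Fin m → Fin N) (a b : Fin m → ℝ) :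
    NullMeasurableSet {x : Fin N → X | ∃ h ∈ H, ∀ i,
      a i < (h (x (π i)) : ℝ) ∧ (h (x (π i)) : ℝ) < b i} (Measure.pi fun _ => P) := by
  classical
  -- Constraints at the same point merge into one interval; the defaults `-1` and `2` impose nothing
  -- on values in `[0,1]`.
  have h := hP N (fun j => (Finset.univ.filter fun i => π i = j).fold max (-1) a)
    (fun j => (Finset.univ.filter fun i => π i = j).fold min 2 b)
  convert h using 6 with x h
  constructor
  · intro hx j
    rw [Finset.fold_max_lt, Finset.lt_fold_min]
    have h0 := (h (x j)).2.1
    have h1 := (h (x j)).2.2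
    refine ⟨⟨by linarith, fun i hi => ?_⟩, ⟨by linarith, fun i hi => ?_⟩⟩ <;>
      obtain rfl := (Finset.mem_filter.1 hi).2
    · exact (hx i).1
    · exact (hx i).2
  · intro hx i
    have hx := hx (π i)
    rw [Finset.fold_max_lt, Finset.lt_fold_min] at hx
    exact ⟨hx.1.2 i (by simp), hx.2.2 i (by simp)⟩

theorem measurePreserving_points (D : Measure (X × unitInterval)) [IsProbabilityMeasure D]
    (s : ℕ) :
    MeasurePreserving (fun (q : (Fin s → X × unitInterval) × (X × unitInterval))
        (j : Fin (s + 1)) => (Fin.insertNth (α := fun _ => X × unitInterval) 0 q.2 q.1 j).1)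
      ((Measure.pi fun _ => D).prod D) (Measure.pi fun _ => D.fst) := by
  have h1 : MeasurePreserving Prod.swap ((Measure.pi fun _ : Fin s => D).prod D)
      (D.prod (Measure.pi fun _ : Fin s => D)) := Measure.measurePreserving_swap
  have h2 := (measurePreserving_piFinSuccAbove (fun _ : Fin (s + 1) => D) 0).symm
  have h3 := measurePreserving_pi (fun _ : Fin (s + 1) => D) (fun _ => D.fst)
    (f := fun _ => Prod.fst) fun _ => ⟨measurable_fst, rfl⟩
  exact h3.comp (h2.comp h1)

theorem aemeasurable_of_nullMeasurableSet {α : Type*} [MeasurableSpace α] {μ : Measure α}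
    {p : α → Prop} (hp : NullMeasurableSet {a | p a} μ) : AEMeasurable p μ := by
  obtain ⟨t, ht, hpt⟩ := hp
  refine ⟨fun a => a ∈ t, measurableSet_setOfPred.1 ht, ?_⟩
  filter_upwards [hpt] with a ha
  exact ha

theorem aemeasurable_mem_traces {D : Measure (X × unitInterval)} [IsProbabilityMeasure D]
    (hD : MeasurableClass H D.fst) {m s : ℕ} (I : Fin m → Fin s) (t : Fin (m + 1))
    (f : Fin (m + 1) → Fin (gridSize γ)) :
    AEMeasurable (fun q : (Fin s → X × unitInterval) × (X × unitInterval) =>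
      f ∈ traces H γ (t.insertNth (α := fun _ => X) q.2.1 fun i => (q.1 (I i)).1))
      ((Measure.pi fun _ => D).prod D) := by
  refine aemeasurable_of_nullMeasurableSet ?_
  have h := (hD.reindex (t.insertNth (α := fun _ => Fin (s + 1)) 0 fun i => (I i).succ)
    (fun i => (((f i : ℕ) : ℝ) - 1) * γ) (fun i => (((f i : ℕ) : ℝ) + 1) * γ)).preimage
      (measurePreserving_points D s).quasiMeasurePreserving
  convert h using 1
  ext q
  simp only [traces, Set.mem_ofPred_eq, Set.mem_preimage]
  have hx : ∀ i, (Fin.insertNth (α := fun _ => X × unitInterval) 0 q.2 q.1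
      (t.insertNth (α := fun _ => Fin (s + 1)) 0 (fun i => (I i).succ) i)).1 =
      t.insertNth (α := fun _ => X) q.2.1 (fun i => (q.1 (I i)).1) i := by
    intro i
    refine Fin.succAboveCases t ?_ (fun l => ?_) i <;> simp
  simp only [hx]

theorem aemeasurable_comp_countable {α Ξ Y Z : Type*} [MeasurableSpace α] [MeasurableSpace Ξ]
    [MeasurableSpace Y] [MeasurableSpace Z] [Countable Ξ] [MeasurableSingletonClass Ξ]
    {μ : Measure α} {ξ : α → Ξ} (hξ : AEMeasurable ξ μ) {y : α → Y} (hy : AEMeasurable y μ)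
    {F : Ξ → Y → Z} (hF : ∀ a, Measurable (F a)) : AEMeasurable (fun q => F (ξ q) (y q)) μ :=
  Measurable.comp_aemeasurable (g := fun p : Ξ × Y => F p.1 p.2)
    (measurable_from_prod_countable_right hF) (hξ.prodMk hy)

/-- The vote `boostList` as a function of the discretized class and labels. -/
noncomputable def boostOfTraces {k T m s g : ℕ} (I : Fin T → Fin m → Fin s)
    (t : Fin T → Fin (m + 1))
    (ξ : (Fin T → (Fin (m + 1) → Fin (g + 1)) → Prop) × (Fin s → Fin (g + 1))) : Fin k → ℕ :=
  vote fun τ => predict k (agreeBefore {f | ξ.1 τ f}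
    ((t τ).insertNth (α := fun _ => Fin (g + 1)) 0 fun i => ξ.2 (I τ i)) (t τ)) (t τ)

/-- The vote depends on the points only through the membership of finitely many grid functions in
the traces, and on the labels only through their buckets. Thus it factors through a finite space,
and membership is null measurable by the assumption on the class. -/
theorem aemeasurable_listLoss_boostList {D : Measure (X × unitInterval)} [IsProbabilityMeasure D]
    (hD : MeasurableClass H D.fst) {k T m s : ℕ} (I : Fin T → Fin m → Fin s)
    (t : Fin T → Fin (m + 1)) :
    AEMeasurable (fun q : (Fin s → X × unitInterval) × (X × unitInterval) =>
      listLoss (toLabels γ (boostList H γ k I t q.1 q.2.1)) q.2.2)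
      ((Measure.pi fun _ => D).prod D) := by
  have h1 : AEMeasurable (fun (q : (Fin s → X × unitInterval) × (X × unitInterval))
      (τ : Fin T) (f : Fin (m + 1) → Fin (gridSize γ)) =>
      f ∈ traces H γ ((t τ).insertNth (α := fun _ => X) q.2.1 fun i => (q.1 (I τ i)).1))
      ((Measure.pi fun _ => D).prod D) := by
    rw [aemeasurable_pi_iff]
    intro τ
    rw [aemeasurable_pi_iff]
    exact fun f => aemeasurable_mem_traces hD (I τ) (t τ) f
  have h2 : AEMeasurable (fun (q : (Fin s → X × unitInterval) × (X × unitInterval)) i =>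
      disc γ (q.1 i).2) ((Measure.pi fun _ => D).prod D) := by
    refine Measurable.aemeasurable (measurable_pi_lambda _ fun i => ?_)
    exact (measurable_disc γ).comp (by fun_prop)
  have hy : AEMeasurable (fun q : (Fin s → X × unitInterval) × (X × unitInterval) => q.2.2)
      ((Measure.pi fun _ => D).prod D) := by fun_prop
  have hb : ∀ q : (Fin s → X × unitInterval) × (X × unitInterval),
      boostList H γ k I t q.1 q.2.1 = boostOfTraces I t
        (fun τ f => f ∈ traces H γ ((t τ).insertNth (α := fun _ => X) q.2.1
          fun i => (q.1 (I τ i)).1), fun i => disc γ (q.1 i).2) := by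
    intro q
    simp only [boostList, boostOfTraces, weakList, Set.ofPred_mem_eq, Function.comp_apply]
  simp only [hb]
  exact aemeasurable_comp_countable (F := fun ξ y => listLoss (toLabels γ (boostOfTraces I t ξ)) y)
    (h1.prodMk h2) hy fun ξ => measurable_listLoss _

end
-- Realizable distributions and the passage from tail mass to expected loss
section
variable {X : Type u} [MeasurableSpace X] {H : Set (X → unitInterval)} {γ : ℝ} {k : ℕ}

theorem Realizable.isProbabilityMeasure {D : Measure (X × unitInterval)} (h : Realizable H D) :
    IsProbabilityMeasure D := by
  obtain ⟨f, -, P, hP, hf, rfl⟩ := h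
  exact Measure.isProbabilityMeasure_map (aemeasurable_id.prodMk hf)

theorem Realizable.exists_ae_eq {D : Measure (X × unitInterval)} (h : Realizable H D) :
    ∃ f ∈ H, ∀ᵐ z ∂D, z.2 = f z.1 := by
  obtain ⟨f, hfH, P, hP, hf, rfl⟩ := h
  refine ⟨f, hfH, ?_⟩
  -- The graph of `f` need not be measurable; that of its measurable version is.
  have hmap : P.map (fun x => (x, f x)) = P.map (fun x => (x, hf.mk f x)) :=
    Measure.map_congr (by filter_upwards [hf.ae_eq_mk] with x hx; rw [hx])
  have hmeas : Measurable fun x => (x, hf.mk f x) := measurable_id.prodMk hf.measurable_mk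
  have h1 : ∀ᵐ z ∂P.map (fun x => (x, hf.mk f x)), z.2 = hf.mk f z.1 := by
    have hset : MeasurableSet {z : X × unitInterval | z.2 = hf.mk f z.1} :=
      measurableSet_eq_fun measurable_snd (hf.measurable_mk.comp measurable_fst)
    rw [ae_map_iff hmeas.aemeasurable hset]
    simp
  have hfst : Measure.QuasiMeasurePreserving Prod.fst (P.map (fun x => (x, hf.mk f x))) P := by
    refine ⟨measurable_fst, ?_⟩
    rw [Measure.map_map measurable_fst hmeas]
    simp [Function.comp_def, Measure.AbsolutelyContinuous.rfl]
  rw [hmap]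
  filter_upwards [h1, hfst.ae hf.ae_eq_mk] with z hz1 hz2
  rw [hz1, hz2]

/-- The loss is at most `τ` off the exceptional set and at most `1` on it. -/
theorem errLE_of_measure_le (hk : 1 ≤ k) {D : Measure (X × unitInterval)} [IsProbabilityMeasure D]
    {l : X → Fin k → unitInterval} (hl : AEMeasurable (fun z => listLoss (l z.1) z.2) D)
    {τ r : ℝ} (hτ : 0 ≤ τ) (hr : 0 ≤ r)
    (h : D {z | τ < listLoss (l z.1) z.2} ≤ ENNReal.ofReal r) : ErrLE D l (τ + r) := by
  have hint : Integrable (fun z : X × unitInterval => listLoss (l z.1) z.2) D :=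
    Integrable.of_bound hl.aestronglyMeasurable 1 (Filter.Eventually.of_forall fun z => by
      rw [Real.norm_of_nonneg (listLoss_nonneg _ _)]
      exact listLoss_le_one hk _ _)
  refine ⟨hint, ?_⟩
  set E := toMeasurable D {z | τ < listLoss (l z.1) z.2}
  have hE : MeasurableSet E := measurableSet_toMeasurable _ _
  have hEr : D.real E ≤ r := by
    refine ENNReal.toReal_le_of_le_ofReal hr ?_
    rw [measure_toMeasurable]
    exact h
  have hind : Integrable (E.indicator fun _ => (1 : ℝ)) D := (integrable_const 1).indicator hE
  calc err D l ≤ ∫ z, (τ + E.indicator (fun _ => (1 : ℝ)) z) ∂D := by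
        refine integral_mono hint ((integrable_const τ).add hind) fun z => ?_
        by_cases hz : z ∈ E
        · simp only [Set.indicator_of_mem hz]
          linarith [listLoss_le_one hk (l z.1) z.2]
        · simp only [Set.indicator_of_notMem hz, add_zero]
          by_contra hcon
          exact hz (subset_toMeasurable _ _ (not_le.1 hcon))
    _ = τ + D.real E := by
        rw [integral_add (integrable_const τ) hind, integral_indicator hE]
        simp
    _ ≤ τ + r := by gcongr

theorem ErrLE.mono {D : Measure (X × unitInterval)} {l : X → Fin k → unitInterval} {r r' : ℝ}
    (h : ErrLE D l r) (hr : r ≤ r') : ErrLE D l r' :=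
  ⟨h.1, h.2.trans hr⟩

theorem SucceedsWHP.mono {A : ListLearner X k} {D : Measure (X × unitInterval)} {n : ℕ}
    {r r' δ : ℝ} (h : SucceedsWHP A D n r δ) (hr : r ≤ r') : SucceedsWHP A D n r' δ :=
  (measure_mono fun S (hS : ¬ ErrLE D (A n S) r') (h' : ErrLE D (A n S) r) =>
    hS (h'.mono hr)).trans h

/-! ### The learner -/

/-- The data that describe a hypothesis relative to a sample of size `n`. -/
abbrev Code (T m n : ℕ) : Type :=
  (Fin (T * m) ↪ Fin n) × (Fin T → Fin m → Fin (T * m)) × (Fin T → Fin (m + 1))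

/-- The hypothesis described by a code. -/
noncomputable def decode (H : Set (X → unitInterval)) (γ : ℝ) (k : ℕ) {T m n : ℕ}
    (c : Code T m n) (S : Fin n → X × unitInterval) (x : X) : Fin k → unitInterval :=
  toLabels γ (boostList H γ k c.2.1 c.2.2 (S ∘ c.1) x)

/-- The hypothesis described by `c` has small loss on the sample. -/
def Fits (H : Set (X → unitInterval)) (γ : ℝ) (k : ℕ) {T m n : ℕ}
    (S : Fin n → X × unitInterval) (c : Code T m n) : Prop :=
  ∀ i, listLoss (decode H γ k c S (S i).1) (S i).2 ≤ 5 * γ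

open Classical in
/-- The learner that outputs some describable hypothesis that fits the sample. -/
noncomputable def compressionLearner (H : Set (X → unitInterval)) (γ : ℝ) (k T m n : ℕ)
    (S : Fin n → X × unitInterval) : X → Fin k → unitInterval :=
  if h : ∃ c : Code T m n, Fits H γ k S c then decode H γ k h.choose S else fun _ _ => 0

theorem card_code_le (T m n : ℕ) :
    Fintype.card (Code T m n) ≤ n ^ (T * m) * ((T * m) ^ (T * m) * (m + 1) ^ T) := by
  simp only [Code, Fintype.card_prod, Fintype.card_embedding_eq, Fintype.card_fun,
    Fintype.card_fin]
  rw [← pow_mul, mul_comm m T]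
  gcongr
  exact Nat.descFactorial_le_pow n _

theorem measure_not_errLE_compressionLearner_le (hγ : 0 < γ) {d m n T : ℕ} (hk : 1 ≤ k)
    (hd : fatDim H (γ / 2) k = (d : ℕ∞)) (hn : 1 ≤ n) (hT0 : 0 < T)
    (hT : 4 * ((k : ℝ) + 1) * Real.log n ≤ T) (hTm : T * m ≤ n)
    (hm : 4 * ((k : ℝ) + 1) * ((k + 2) *
      (d * Real.log (((m + 1 : ℕ) : ℝ) * (gridSize γ : ℝ) ^ k + 1))) ≤ m + 1)
    {D : Measure (X × unitInterval)} (hreal : Realizable H D) (hD : MeasurableClass H D.fst)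
    {r : ℝ} (hr : 0 ≤ r) :
    (Measure.pi fun _ : Fin n => D)
      {S | ¬ ErrLE D (compressionLearner H γ k T m n S) (5 * γ + r)} ≤
      ENNReal.ofReal (Fintype.card (Code T m n) *
        Real.exp (-(r * ((n : ℝ) - (T * m : ℕ))))) := by
  have := hreal.isProbabilityMeasure
  obtain ⟨f, hfH, hf⟩ := hreal.exists_ae_eq
  -- A realizable sample almost surely has a fitting code, so failure means that some code fits and
  -- still has large error: a union bound over codes applies.
  let bad : Code T m n → Set (Fin n → X × unitInterval) := fun c =>
    {S | Fits H γ k S c ∧ ¬ ErrLE D (decode H γ k c S) (5 * γ + r)}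
  have hbad : ∀ c, (Measure.pi fun _ : Fin n => D) (bad c) ≤
      ENNReal.ofReal (Real.exp (-(r * ((n : ℝ) - (T * m : ℕ))))) := by
    intro c
    have hc := measure_consistent_and_not_le D c.1
      (fun q => listLoss (toLabels γ (boostList H γ k c.2.1 c.2.2 q.1 q.2.1)) q.2.2)
      (aemeasurable_listLoss_boostList (γ := γ) (k := k) hD c.2.1 c.2.2) (5 * γ) hr
    refine le_trans (measure_mono ?_) hc
    rintro S ⟨hS1, hS2⟩
    exact ⟨hS1, fun h => hS2 (errLE_of_measure_le (l := decode H γ k c S) hk h.1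
      (by positivity) hr h.2)⟩
  have hae : ∀ᵐ S ∂(Measure.pi fun _ : Fin n => D), ∀ i, (S i).2 = f (S i).1 := by
    rw [ae_all_iff]
    exact fun i => (measurePreserving_eval (fun _ : Fin n => D) i).quasiMeasurePreserving.ae hf
  calc (Measure.pi fun _ : Fin n => D)
        {S | ¬ ErrLE D (compressionLearner H γ k T m n S) (5 * γ + r)}
      ≤ (Measure.pi fun _ : Fin n => D) (⋃ c, bad c) := by
        refine measure_mono_ae ?_
        filter_upwards [hae] with S hS hfail
        obtain ⟨e, I, t, hfit⟩ :=
          exists_boostList_consistent hγ hk hd hn hT0 hT hTm hm hfH S hS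
        have hex : ∃ c : Code T m n, Fits H γ k S c := ⟨(e, I, t), hfit⟩
        refine Set.mem_iUnion.2 ⟨hex.choose, hex.choose_spec, ?_⟩
        have hfail' : ¬ ErrLE D (compressionLearner H γ k T m n S) (5 * γ + r) := hfail
        rwa [compressionLearner, dif_pos hex] at hfail'
    _ ≤ ∑ c, (Measure.pi fun _ : Fin n => D) (bad c) := measure_iUnion_fintype_le _ _
    _ ≤ ∑ _c : Code T m n, ENNReal.ofReal (Real.exp (-(r * ((n : ℝ) - (T * m : ℕ))))) :=
        Finset.sum_le_sum fun c _ => hbad c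
    _ = _ := by
        rw [Finset.sum_const, Finset.card_univ, nsmul_eq_mul,
          ENNReal.ofReal_mul (Nat.cast_nonneg _), ENNReal.ofReal_natCast]

/-! ### Choice of the parameters -/

/-- The logarithmic factor of the error bound. -/
noncomputable def logFactor (γ : ℝ) (k n : ℕ) : ℝ := Real.log (2 + n * k / γ)

/-- The size of the subsample of a weak predictor. -/
noncomputable def weakSize (γ : ℝ) (k d n : ℕ) : ℕ := d * ⌈96 * (k : ℝ) ^ 3 * logFactor γ k n⌉₊

/-- The number of weak predictors. -/
noncomputable def numRounds (γ : ℝ) (k n : ℕ) : ℕ := 4 * (k + 1) * ⌈logFactor γ k n⌉₊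

open Classical in
/-- The learner of the main theorem. -/
noncomputable def learner (H : Set (X → unitInterval)) (γ : ℝ) (k d : ℕ) : ListLearner X k :=
  fun n => if 2 * (numRounds γ k n * weakSize γ k d n) ≤ n then
    compressionLearner H γ k (numRounds γ k n) (weakSize γ k d n) n else fun _ _ _ => 0

end

section
variable {γ : ℝ} {k d n : ℕ}

theorem one_le_mul_div (hγ : 0 < γ) (hγ1 : γ < 1) (hk : 1 ≤ k) (hn : 1 ≤ n) :
    1 / γ ≤ n * k / γ ∧ 1 ≤ 1 / γ ∧ (n : ℝ) ≤ n * k / γ := by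
  have hk' : (1 : ℝ) ≤ k := by exact_mod_cast hk
  have hn' : (1 : ℝ) ≤ n := by exact_mod_cast hn
  refine ⟨?_, ?_, ?_⟩
  · gcongr
    nlinarith
  · rw [le_div_iff₀ hγ]
    linarith
  · rw [le_div_iff₀ hγ]
    nlinarith

theorem one_le_log_of_three_le {x : ℝ} (hx : 3 ≤ x) : 1 ≤ Real.log x := by
  rw [Real.le_log_iff_exp_le (by linarith)]
  linarith [Real.exp_one_lt_d9]

theorem one_le_logFactor (hγ : 0 < γ) (hγ1 : γ < 1) (hk : 1 ≤ k) (hn : 1 ≤ n) :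
    1 ≤ logFactor γ k n := by
  obtain ⟨h1, h2, -⟩ := one_le_mul_div hγ hγ1 hk hn
  exact one_le_log_of_three_le (by linarith)

theorem log_le_logFactor (hγ : 0 < γ) (hγ1 : γ < 1) (hk : 1 ≤ k) (hn : 1 ≤ n) :
    Real.log n ≤ logFactor γ k n := by
  obtain ⟨-, -, h3⟩ := one_le_mul_div hγ hγ1 hk hn
  have hn' : (0 : ℝ) < n := by exact_mod_cast hn
  exact Real.log_le_log hn' (by linarith)

/-- Both the sample size and the grid size are at most `Q = 2 + n * k / γ`, so the pattern bound
contributes at most the power `Q ^ (k + 2)`. -/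
theorem log_grid_le (hγ : 0 < γ) (hγ1 : γ < 1) (hk : 1 ≤ k) (hn : 1 ≤ n) {m : ℕ} (hm : m ≤ n) :
    Real.log ((m : ℝ) * (gridSize γ : ℝ) ^ k + 1) ≤ (k + 2) * logFactor γ k n := by
  obtain ⟨h1, h2, h3⟩ := one_le_mul_div hγ hγ1 hk hn
  set Q : ℝ := 2 + n * k / γ with hQ
  have hm' : (m : ℝ) ≤ Q := by
    have : (m : ℝ) ≤ n := by exact_mod_cast hm
    linarith
  have hg : (gridSize γ : ℝ) ≤ Q := by
    have := Nat.floor_le (by positivity : 0 ≤ 1 / γ)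
    push_cast
    linarith
  have hQ2 : 2 ≤ Q := by linarith
  have hle : (m : ℝ) * (gridSize γ : ℝ) ^ k + 1 ≤ Q ^ (k + 2) := by
    have h4 : (m : ℝ) * (gridSize γ : ℝ) ^ k ≤ Q * Q ^ k := by gcongr
    have h5 : (1 : ℝ) ≤ Q * Q ^ k := by
      rw [← pow_succ']
      exact one_le_pow₀ (by linarith)
    calc (m : ℝ) * (gridSize γ : ℝ) ^ k + 1 ≤ 2 * (Q * Q ^ k) := by linarith
      _ ≤ Q * (Q * Q ^ k) := by gcongr
      _ = Q ^ (k + 2) := by ring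
  have h6 := Real.log_le_log (by positivity) hle
  rw [Real.log_pow] at h6
  simpa [logFactor] using h6

theorem numRounds_mul_weakSize_le (hγ : 0 < γ) (hγ1 : γ < 1) (hk : 1 ≤ k) (hn : 1 ≤ n) :
    ((numRounds γ k n * weakSize γ k d n : ℕ) : ℝ) ≤
      1552 * (k : ℝ) ^ 4 * d * logFactor γ k n ^ 2 := by
  have hℓ := one_le_logFactor hγ hγ1 hk hn
  have hk' : (1 : ℝ) ≤ k := by exact_mod_cast hk
  set ℓ := logFactor γ k n
  have hk3 : (1 : ℝ) ≤ (k : ℝ) ^ 3 := one_le_pow₀ hk'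
  have h1 : (⌈ℓ⌉₊ : ℝ) ≤ 2 * ℓ := by
    have := Nat.ceil_lt_add_one (by linarith : 0 ≤ ℓ)
    linarith
  have h2 : (⌈96 * (k : ℝ) ^ 3 * ℓ⌉₊ : ℝ) ≤ 97 * (k : ℝ) ^ 3 * ℓ := by
    have := Nat.ceil_lt_add_one (by positivity : 0 ≤ 96 * (k : ℝ) ^ 3 * ℓ)
    nlinarith
  simp only [numRounds, weakSize]
  push_cast
  calc 4 * ((k : ℝ) + 1) * ⌈ℓ⌉₊ * (d * ⌈96 * (k : ℝ) ^ 3 * ℓ⌉₊)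
      ≤ 4 * ((k : ℝ) + k) * (2 * ℓ) * (d * (97 * (k : ℝ) ^ 3 * ℓ)) := by gcongr
    _ = 1552 * (k : ℝ) ^ 4 * d * ℓ ^ 2 := by ring

/-- With `1 ≤ k` the left side is at most `4 * 2 * 3 * 3 = 72` times `d * k ^ 3 * ℓ`, and the factor
`96` in `weakSize` dominates it. -/
theorem weakSize_spec (hγ : 0 < γ) (hγ1 : γ < 1) (hk : 1 ≤ k) (hn : 1 ≤ n)
    (hm : weakSize γ k d n + 1 ≤ n) :
    4 * ((k : ℝ) + 1) * ((k + 2) * (d * Real.log (((weakSize γ k d n + 1 : ℕ) : ℝ) *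
      (gridSize γ : ℝ) ^ k + 1))) ≤ weakSize γ k d n + 1 := by
  have hℓ := one_le_logFactor hγ hγ1 hk hn
  have hk' : (1 : ℝ) ≤ k := by exact_mod_cast hk
  have hlog := log_grid_le hγ hγ1 hk hn hm
  have h0 : 0 ≤ Real.log (((weakSize γ k d n + 1 : ℕ) : ℝ) * (gridSize γ : ℝ) ^ k + 1) :=
    Real.log_nonneg (by
      have : 0 ≤ ((weakSize γ k d n + 1 : ℕ) : ℝ) * (gridSize γ : ℝ) ^ k := by positivity
      linarith)
  set ℓ := logFactor γ k n
  have hw : (d : ℝ) * (96 * (k : ℝ) ^ 3 * ℓ) ≤ weakSize γ k d n := by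
    simp only [weakSize]
    push_cast
    gcongr
    exact Nat.le_ceil _
  calc 4 * ((k : ℝ) + 1) * ((k + 2) * (d * Real.log (((weakSize γ k d n + 1 : ℕ) : ℝ) *
        (gridSize γ : ℝ) ^ k + 1)))
      ≤ 4 * ((k : ℝ) + k) * ((k + 2 * k) * (d * ((k + 2 * k) * ℓ))) := by
        gcongr
        · linarith
        · refine hlog.trans ?_
          gcongr
          linarith
    _ = 72 * (d * ((k : ℝ) ^ 3 * ℓ)) := by ring
    _ ≤ 96 * (d * ((k : ℝ) ^ 3 * ℓ)) := by
        gcongr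
        norm_num
    _ ≤ weakSize γ k d n + 1 := by linarith

/-- There are at most `n ^ (3 * T * m)` codes, and at least half of the sample is left for testing,
which the factor `2` in the rate absorbs. -/
theorem card_code_mul_exp_le (hγ : 0 < γ) (hγ1 : γ < 1) (hk : 1 ≤ k) (hn : 1 ≤ n) {T m : ℕ}
    (hT : 2 ≤ T) (hTm : 2 * (T * m) ≤ n) {δ : ℝ} (hδ : 0 < δ) (hδ1 : δ < 1) :
    Fintype.card (Code T m n) * Real.exp (-((2 * (3 * (T * m : ℕ) * logFactor γ k n +
      Real.log (1 / δ)) / n) * ((n : ℝ) - (T * m : ℕ)))) ≤ δ := by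
  set s := T * m with hs
  have hL : 0 ≤ Real.log (1 / δ) := Real.log_nonneg (by rw [le_div_iff₀ hδ]; linarith)
  have hℓ := one_le_logFactor hγ hγ1 hk hn
  have hlog := log_le_logFactor hγ hγ1 hk hn
  set ℓ := logFactor γ k n
  have hn' : (0 : ℝ) < n := by exact_mod_cast hn
  have hcard : Fintype.card (Code T m n) ≤ n ^ (3 * s) := by
    refine (card_code_le T m n).trans ?_
    have h1 : (m + 1) ^ T ≤ n ^ s := by
      rcases Nat.eq_zero_or_pos m with rfl | hm
      · simpa using Nat.one_le_pow _ _ hn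
      · have : m + 1 ≤ n := by nlinarith
        calc (m + 1) ^ T ≤ n ^ T := by gcongr
          _ ≤ n ^ s := Nat.pow_le_pow_right hn (by nlinarith)
    calc n ^ s * (s ^ s * (m + 1) ^ T) ≤ n ^ s * (n ^ s * n ^ s) := by
          gcongr
          omega
      _ = n ^ (3 * s) := by ring
  have hcard' : (Fintype.card (Code T m n) : ℝ) ≤ Real.exp (3 * s * ℓ) := by
    calc (Fintype.card (Code T m n) : ℝ) ≤ (n : ℝ) ^ (3 * s) := by exact_mod_cast hcard
      _ = Real.exp (3 * s * Real.log n) := by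
        rw [← Real.exp_log hn', ← Real.exp_nat_mul, Real.exp_log hn']
        push_cast
        rfl
      _ ≤ _ := by gcongr
  have hs' : 2 * (s : ℝ) ≤ n := by exact_mod_cast hTm
  have hexp : 3 * s * ℓ + Real.log (1 / δ) ≤
      2 * (3 * s * ℓ + Real.log (1 / δ)) / n * ((n : ℝ) - s) := by
    rw [div_mul_eq_mul_div, le_div_iff₀ hn']
    have h0 : 0 ≤ 3 * s * ℓ + Real.log (1 / δ) := by positivity
    nlinarith
  calc _ ≤ Real.exp (3 * s * ℓ) * Real.exp (-(3 * s * ℓ + Real.log (1 / δ))) := by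
        gcongr
    _ = Real.exp (-Real.log (1 / δ)) := by
        rw [← Real.exp_add]
        congr 1
        ring
    _ = δ := by
        rw [one_div, Real.log_inv, neg_neg, Real.exp_log hδ]

theorem succeedsWHP_learner {X : Type u} [MeasurableSpace X] {H : Set (X → unitInterval)}
    (hγ : 0 < γ) (hγ1 : γ < 1) (hk : 1 ≤ k) (hn : 1 ≤ n)
    (hd : fatDim H (γ / 2) k = (d : ℕ∞)) {δ : ℝ} (hδ : 0 < δ) (hδ1 : δ < 1)
    {D : Measure (X × unitInterval)} (hreal : Realizable H D) (hD : MeasurableClass H D.fst) :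
    SucceedsWHP (learner H γ k d) D n (5 * γ + 10 ^ 4 *
      (((k : ℝ) ^ 8 * d + Real.log (1 / δ)) / n) * logFactor γ k n ^ 3) δ := by
  have hL : 0 ≤ Real.log (1 / δ) := Real.log_nonneg (by rw [le_div_iff₀ hδ]; linarith)
  have hℓ := one_le_logFactor hγ hγ1 hk hn
  have hlog := log_le_logFactor hγ hγ1 hk hn
  have hsle := numRounds_mul_weakSize_le (d := d) hγ hγ1 hk hn
  have hspec := weakSize_spec (d := d) hγ hγ1 hk hn
  have hcard := fun hT hTm => card_code_mul_exp_le hγ hγ1 hk hn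
    (T := numRounds γ k n) (m := weakSize γ k d n) hT hTm hδ hδ1
  have hT4 : 4 ≤ numRounds γ k n := by
    have : 1 ≤ ⌈logFactor γ k n⌉₊ := Nat.one_le_ceil_iff.2 (by linarith)
    unfold numRounds
    nlinarith
  have hTlog : 4 * ((k : ℝ) + 1) * Real.log n ≤ numRounds γ k n := by
    unfold numRounds
    push_cast
    gcongr
    exact hlog.trans (Nat.le_ceil _)
  set T := numRounds γ k n
  set m := weakSize γ k d n
  set ℓ := logFactor γ k n
  have hk' : (1 : ℝ) ≤ k := by exact_mod_cast hk
  have hn' : (0 : ℝ) < n := by exact_mod_cast hn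
  -- The construction costs only `k ^ 4`; the eighth power is slack.
  have hk48 : (k : ℝ) ^ 4 * d ≤ (k : ℝ) ^ 8 * d := by
    gcongr
    norm_num
  have hprob := hreal.isProbabilityMeasure
  unfold SucceedsWHP
  by_cases hTm : 2 * (T * m) ≤ n
  · have hlearn : learner H γ k d n = compressionLearner H γ k T m n := if_pos hTm
    have hmn : m + 1 ≤ n := by
      rcases Nat.eq_zero_or_pos m with h0 | hm
      · omega
      · nlinarith
    have hmain := measure_not_errLE_compressionLearner_le hγ hk hd hn (by omega) hTlog
      (by omega) (hspec hmn) hreal hD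
      (r := 2 * (3 * (T * m : ℕ) * ℓ + Real.log (1 / δ)) / n) (by positivity)
    refine le_trans (measure_mono ?_) (hmain.trans (ENNReal.ofReal_le_ofReal
      (hcard (by omega) hTm)))
    intro S hS hS'
    refine hS ?_
    rw [hlearn]
    refine hS'.mono ?_
    have hℓ2 : ℓ ≤ ℓ ^ 3 := le_self_pow₀ hℓ (by norm_num)
    have hℓ3 : 1 ≤ ℓ ^ 3 := one_le_pow₀ hℓ
    have : 2 * (3 * (T * m : ℕ) * ℓ + Real.log (1 / δ)) ≤
        10 ^ 4 * ((k : ℝ) ^ 8 * d + Real.log (1 / δ)) * ℓ ^ 3 := by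
      have h1 : ((T * m : ℕ) : ℝ) * ℓ ≤ 1552 * ((k : ℝ) ^ 8 * d) * ℓ ^ 3 := by
        calc ((T * m : ℕ) : ℝ) * ℓ ≤ 1552 * (k : ℝ) ^ 4 * d * ℓ ^ 2 * ℓ := by gcongr
          _ = 1552 * ((k : ℝ) ^ 4 * d) * ℓ ^ 3 := by ring
          _ ≤ _ := by gcongr
      have h2 : Real.log (1 / δ) ≤ Real.log (1 / δ) * ℓ ^ 3 := le_mul_of_one_le_right hL hℓ3
      have h3 : 0 ≤ (k : ℝ) ^ 8 * d * ℓ ^ 3 := by positivity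
      nlinarith
    calc 5 * γ + 2 * (3 * (T * m : ℕ) * ℓ + Real.log (1 / δ)) / n
        ≤ 5 * γ + 10 ^ 4 * ((k : ℝ) ^ 8 * d + Real.log (1 / δ)) * ℓ ^ 3 / n := by gcongr
      _ = _ := by ring
  -- For so small a sample the claimed bound is at least `1`, and any list with measurable loss will
  -- do.
  · have hlearn : learner H γ k d n = fun _ _ _ => 0 := if_neg hTm
    refine le_of_eq_of_le ?_ zero_le
    convert measure_empty (μ := Measure.pi fun _ : Fin n => D)
    rw [Set.eq_empty_iff_forall_notMem]
    intro S hS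
    refine hS ?_
    rw [hlearn]
    have h1 := errLE_of_measure_le hk (D := D) (l := fun _ _ => 0) (τ := 0) (r := 1)
      ((measurable_listLoss _).comp measurable_snd).aemeasurable le_rfl zero_le_one
      (by simpa using prob_le_one)
    refine h1.mono ?_
    have h2 : (n : ℝ) ≤ 10 ^ 4 * ((k : ℝ) ^ 8 * d + Real.log (1 / δ)) * ℓ ^ 3 := by
      have h3 : (n : ℝ) ≤ 2 * (T * m : ℕ) := by exact_mod_cast (not_le.1 hTm).le
      have h4 : (k : ℝ) ^ 4 * d * ℓ ^ 2 ≤ ((k : ℝ) ^ 8 * d) * ℓ ^ 3 := by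
        gcongr
        all_goals norm_num
      have h5 : 0 ≤ Real.log (1 / δ) * ℓ ^ 3 := by positivity
      have h6 : 0 ≤ (k : ℝ) ^ 8 * d * ℓ ^ 3 := by positivity
      nlinarith
    have h7 : 1 ≤ 10 ^ 4 * (((k : ℝ) ^ 8 * d + Real.log (1 / δ)) / n) * ℓ ^ 3 := by
      rw [mul_div_assoc', div_mul_eq_mul_div, le_div_iff₀ hn']
      linarith
    linarith

/-! ### Inversion of the error bound into a sample size -/

theorem exists_pow_three_eq {x : ℝ} (hx : 1 ≤ x) : ∃ σ : ℝ, 1 ≤ σ ∧ σ ^ 3 = x :=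
  ⟨x ^ ((3 : ℕ) : ℝ)⁻¹, Real.one_le_rpow hx (by positivity),
    Real.rpow_inv_natCast_pow (zero_le_one.trans hx) (by norm_num)⟩

theorem pow_mul_add_mul_le {Z k d L e : ℝ} (hZ : 3 ≤ Z) (hk : 0 ≤ k) (hd : 0 ≤ d)
    (he : 0 ≤ e) (hkZ : k ≤ Z) (hdZ : d ≤ Z) (hLZ : L ≤ Z) (heZ : e ≤ Z) :
    (k ^ 8 * d + L) * e ≤ Z ^ 11 := by
  have hZ0 : 0 ≤ Z := by linarith
  have h1 : k ^ 8 * d ≤ Z ^ 9 := by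
    calc k ^ 8 * d ≤ Z ^ 8 * Z := by gcongr
      _ = Z ^ 9 := by ring
  have h2 : L ≤ Z ^ 9 := hLZ.trans (le_self_pow₀ (by linarith) (by norm_num))
  calc (k ^ 8 * d + L) * e ≤ (Z ^ 9 + Z ^ 9) * Z := by gcongr
    _ = 2 * Z ^ 10 := by ring
    _ ≤ Z * Z ^ 10 := by
        gcongr
        linarith
    _ = Z ^ 11 := by ring

theorem two_add_mul_le {C Z A l k e σ : ℝ} (hC : 1 ≤ C) (hZ : 3 ≤ Z) (hl : 0 ≤ l)
    (hk : 0 ≤ k) (he : 0 ≤ e) (hσ : 1 ≤ σ) (hAZ : A ≤ Z ^ 11) (hlZ : l ≤ Z) (hkZ : k ≤ Z)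
    (heZ : e ≤ Z) : 2 + C ^ 2 * (A * l ^ 3 * (k * e)) * σ ^ 3 ≤ C ^ 2 * Z ^ 17 * σ ^ 3 := by
  have hZ0 : 0 ≤ Z := by linarith
  have h1 : A * l ^ 3 * (k * e) ≤ Z ^ 16 := by
    calc A * l ^ 3 * (k * e) ≤ Z ^ 11 * Z ^ 3 * (Z * Z) := by gcongr
      _ = Z ^ 16 := by ring
  have h2 : C ^ 2 * (A * l ^ 3 * (k * e)) * σ ^ 3 ≤ C ^ 2 * Z ^ 16 * σ ^ 3 := by gcongr
  have h3 : 1 ≤ C ^ 2 * Z ^ 16 * σ ^ 3 :=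
    one_le_mul_of_one_le_of_one_le (one_le_mul_of_one_le_of_one_le (one_le_pow₀ hC)
      (one_le_pow₀ (by linarith))) (one_le_pow₀ hσ)
  have h4 : C ^ 2 * Z ^ 17 * σ ^ 3 = Z * (C ^ 2 * Z ^ 16 * σ ^ 3) := by ring
  rw [h4]
  generalize C ^ 2 * Z ^ 16 * σ ^ 3 = q at *
  nlinarith

/-- The constant is `76 = 2 * 28 + 17 + 3`, one summand for each factor. -/
theorem log_pow_mul_le {C Z σ : ℝ} (hC : 1 ≤ C) (hC28 : Real.log C ≤ 28) (hZ : 3 ≤ Z)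
    (hσ : 1 ≤ σ) : Real.log (C ^ 2 * Z ^ 17 * σ ^ 3) ≤ 76 * Real.log Z * σ := by
  have hZ0 : 0 < Z := by linarith
  have hC0 : 0 < C := by linarith
  have hσ0 : 0 < σ := by linarith
  rw [Real.log_mul (by positivity) (by positivity), Real.log_mul (by positivity) (by positivity),
    Real.log_pow, Real.log_pow, Real.log_pow]
  have hl1 := one_le_log_of_three_le hZ
  have h2 := Real.log_le_sub_one_of_pos hσ0
  generalize Real.log Z = l at *
  have h3 : 1 ≤ l * σ := one_le_mul_of_one_le_of_one_le hl1 hσ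
  have h4 : l ≤ l * σ := le_mul_of_one_le_right (by linarith) hσ
  have h5 : σ ≤ l * σ := le_mul_of_one_le_left (by linarith) hl1
  push_cast
  linarith

/-- Inversion of the error bound. -/
theorem error_bound_le_of_sample_size {C ε k d L n : ℝ} (hC : 2 * 10 ^ 4 * 76 ^ 3 ≤ C)
    (hC28 : Real.log C ≤ 28) (hε : 0 < ε) (hε1 : ε < 1) (hk : 1 ≤ k) (hd : 0 ≤ d) (hL : 0 < L)
    (hn : C * ((k ^ 8 * d + L) / ε) * Real.log (2 + k / ε + d + L) ^ 3 ≤ n) :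
    10 ^ 4 * ((k ^ 8 * d + L) / n) * Real.log (2 + n * k / (ε / (C * k))) ^ 3 ≤ ε / 2 := by
  have hC1 : 1 ≤ C := le_trans (by norm_num) hC
  have hC0 : 0 < C := by linarith
  have hk0 : 0 < k := by linarith
  have hkε : k ≤ k / ε := by
    rw [le_div_iff₀ hε]
    nlinarith
  have h1ε : ε⁻¹ ≤ k / ε := by
    rw [← one_div]
    gcongr
  have hlZ : Real.log (2 + k / ε + d + L) ≤ 2 + k / ε + d + L := by
    have := Real.log_le_sub_one_of_pos (x := 2 + k / ε + d + L) (by positivity)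
    linarith
  obtain ⟨Z, hZ⟩ : ∃ Z, Z = 2 + k / ε + d + L := ⟨_, rfl⟩
  rw [← hZ] at hn hlZ
  have hZ3 : 3 ≤ Z := by linarith
  have hl1 : 1 ≤ Real.log Z := one_le_log_of_three_le hZ3
  have hAZ : (k ^ 8 * d + L) * ε⁻¹ ≤ Z ^ 11 :=
    pow_mul_add_mul_le hZ3 hk0.le hd (by positivity) (by linarith) (by linarith)
      (by linarith) (by linarith)
  obtain ⟨A, hA⟩ : ∃ A, A = (k ^ 8 * d + L) / ε := ⟨_, rfl⟩
  rw [← div_eq_mul_inv, ← hA] at hAZ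
  rw [← hA] at hn
  have hA0 : 0 < A := by
    rw [hA]
    positivity
  have hAε : k ^ 8 * d + L = A * ε := by
    rw [hA]
    field_simp
  have hN0 : 0 < C * A * Real.log Z ^ 3 := by positivity
  -- `σ ^ 3` is the ratio of `n` to the required size. The logarithm grows at most linearly in `σ`,
  -- so its cube is compensated by the `1 / n` in the bound, uniformly in `n`.
  obtain ⟨σ, hσ, hσn⟩ := exists_pow_three_eq ((one_le_div hN0).2 hn)
  have hnσ : n = C * A * Real.log Z ^ 3 * σ ^ 3 := by
    rw [hσn, mul_div_cancel₀ _ hN0.ne']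
  have hlog : Real.log (2 + n * k / (ε / (C * k))) ≤ 76 * Real.log Z * σ := by
    refine le_trans (Real.log_le_log ?_ ?_) (log_pow_mul_le hC1 hC28 hZ3 hσ)
    · have : 0 ≤ n := hN0.le.trans hn
      positivity
    · have h1 := two_add_mul_le hC1 hZ3 (by linarith : 0 ≤ Real.log Z) hk0.le
        (by positivity : 0 ≤ k / ε) hσ hAZ hlZ (by linarith) (by linarith)
      refine le_trans (le_of_eq ?_) h1
      rw [hnσ]
      field_simp
  have hlog0 : 0 ≤ Real.log (2 + n * k / (ε / (C * k))) := by
    refine Real.log_nonneg ?_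
    have h0 : 0 ≤ n := hN0.le.trans hn
    have : 0 ≤ n * k / (ε / (C * k)) := by positivity
    linarith
  have hn0 : 0 < n := hN0.trans_le hn
  rw [hAε]
  calc 10 ^ 4 * (A * ε / n) * Real.log (2 + n * k / (ε / (C * k))) ^ 3
      ≤ 10 ^ 4 * (A * ε / n) * (76 * Real.log Z * σ) ^ 3 := by gcongr
    _ = 10 ^ 4 * 76 ^ 3 / C * ε := by
        rw [hnσ]
        field_simp
    _ ≤ 1 / 2 * ε := by
        refine mul_le_mul_of_nonneg_right ?_ hε.le
        rw [div_le_div_iff₀ hC0 (by norm_num)]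
        linarith
    _ = ε / 2 := by ring

end
end ListRegression

theorem mainTheorem5 :
    ∃ C : ℝ, 0 < C ∧ ∃ p : ℕ,
      ∀ (X : Type u) [MeasurableSpace X] (H : Set (X → unitInterval)) (k d : ℕ) (γ : ℝ),
        1 ≤ k → 0 < γ → γ < 1 → ListRegression.fatDim H (γ / 2) k = (d : ℕ∞) →
        ∃ A : ListRegression.ListLearner X k,
          (∀ (n : ℕ) (δ : ℝ), 1 ≤ n → 0 < δ → δ < 1 →
            ∀ D : MeasureTheory.Measure (X × unitInterval),
              ListRegression.Realizable H D → ListRegression.MeasurableClass H D.fst →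
              ListRegression.SucceedsWHP A D n
                (C * k * γ +
                  C * (((k : ℝ) ^ 8 * d + Real.log (1 / δ)) / n) *
                    Real.log (2 + n * k / γ) ^ p) δ) ∧
          (∀ ε δ : ℝ, 0 < ε → ε < 1 → 0 < δ → δ < 1 → γ = ε / (C * k) →
            ∀ n : ℕ,
              C * (((k : ℝ) ^ 8 * d + Real.log (1 / δ)) / ε) *
                  Real.log (2 + k / ε + d + Real.log (1 / δ)) ^ p ≤ n →
              ∀ D : MeasureTheory.Measure (X × unitInterval),
                ListRegression.Realizable H D → ListRegression.MeasurableClass H D.fst →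
                ListRegression.SucceedsWHP A D n ε δ) := by
  -- `C = 2 ^ 40` is large enough for `2 * 10 ^ 4 * 76 ^ 3 ≤ C` and small enough for `log C ≤ 28`,
  -- as the inversion requires.
  refine ⟨2 ^ 40, by positivity, 3, fun X _ H k d γ hk hγ hγ1 hd =>
    ⟨ListRegression.learner H γ k d, fun n δ hn hδ hδ1 D hreal hD => ?_,
      fun ε δ hε hε1 hδ hδ1 hγε n hn D hreal hD => ?_⟩⟩
  · refine (ListRegression.succeedsWHP_learner hγ hγ1 hk hn hd hδ hδ1 hreal hD).mono ?_
    have hk' : (1 : ℝ) ≤ k := by exact_mod_cast hk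
    have hL : 0 ≤ Real.log (1 / δ) := Real.log_nonneg (by rw [le_div_iff₀ hδ]; linarith)
    have hℓ := ListRegression.one_le_logFactor hγ hγ1 hk hn
    have h1 : 5 * γ ≤ 2 ^ 40 * k * γ := by
      gcongr
      linarith
    refine add_le_add h1 ?_
    have h2 : 0 ≤ Real.log (2 + n * k / γ) := zero_le_one.trans hℓ
    unfold ListRegression.logFactor
    gcongr
    norm_num
  · have hk' : (1 : ℝ) ≤ k := by exact_mod_cast hk
    have hL : 0 < Real.log (1 / δ) := Real.log_pos (by rw [lt_div_iff₀ hδ]; linarith)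
    have hZ : 0 < Real.log (2 + k / ε + d + Real.log (1 / δ)) := Real.log_pos (by
      have : 0 ≤ (k : ℝ) / ε := by positivity
      have : (0 : ℝ) ≤ d := by positivity
      linarith)
    have hn0 : (0 : ℝ) < n := lt_of_lt_of_le (by positivity) hn
    have hn1 : 1 ≤ n := by exact_mod_cast hn0
    refine (ListRegression.succeedsWHP_learner hγ hγ1 hk hn1 hd hδ hδ1 hreal hD).mono ?_
    have h1 := ListRegression.error_bound_le_of_sample_size (C := 2 ^ 40) (by norm_num) (by
      rw [Real.log_pow]
      push_cast
      linarith [Real.log_two_lt_d9]) hε hε1 hk' (Nat.cast_nonneg d) hL hn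
    have h2 : 5 * γ ≤ ε / 2 := by
      rw [hγε, mul_div_assoc', div_le_div_iff₀ (by positivity) (by norm_num)]
      nlinarith
    rw [← hγε] at h1
    unfold ListRegression.logFactor
    linarith
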